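/- Let $N\ge 3$ be an integer, $p\ge 1$, $q>0$ and $\beta>0$, and let $K_{N,\beta}(x)=|x|^{-N}\log^{\beta}(1+|x|)$ for $x\in\mathbb{R}^N\setminus\{0\}$. For $\lambda>0$, consider the inequality $$\Delta^2u-\lambda\Delta u\ \ge\ (K_{N,\beta}*u^p)\,u^q\quad\text{in }\mathbb{R}^N,\qquad (P^+)$$ where $(K_{N,\beta}*u^p)(x)=\int_{\mathbb{R}^N}K_{N,\beta}(x-y)\,u(y)^p\,dy$. A non-negative solution of $(P^+)$ is a function $u\in C^4(\mathbb{R}^N)$ with $u\not\equiv 0$ such that $u(x)\ge 0$ and $(K_{N,\beta}*u^p)(x)<\infty$ for all $x\in\mathbb{R}^N$, and such that $(P^+)$ holds at every point of $\mathbb{R}^N$. Then there exists $\lambda>0$ for which $(P^+)$ has a non-negative solution if and only if $$p+q>\frac{N}{N-2}.$$ -/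

import Mathlib

open scoped Convolution

noncomputable section

/-- The potential `K_{α,β}(x) = |x|^{-α} log^β (1 + |x|)` on `ℝ^N`. -/
def logRieszKernel (N : ℕ) (α β : ℝ) (x : EuclideanSpace ℝ (Fin N)) : ℝ :=
  ‖x‖ ^ (-α) * Real.log (1 + ‖x‖) ^ β

/-- `u` is a (classical, nontrivial) non-negative solution on `ℝ^N` of
`Δ² u - lam Δ u ≥ (K_{α,β} * u^p) u^q`. -/
structure IsNonnegSolution (N : ℕ) (α β lam p q : ℝ)
    (u : EuclideanSpace ℝ (Fin N) → ℝ) : Prop where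
  /-- `u` is of class `C⁴`. -/
  contDiff : ContDiff ℝ 4 u
  /-- `u ≥ 0` everywhere. -/
  nonneg : ∀ x, 0 ≤ u x
  /-- `u` does not vanish identically. -/
  nontrivial : ∃ x, u x ≠ 0
  /-- `(K_{α,β} * u^p)(x) < ∞` for all `x`: the integral of the non-negative function
  `y ↦ K_{α,β}(y) u(x - y)^p` converges. -/
  convolutionExists :
    MeasureTheory.ConvolutionExists (logRieszKernel N α β) (fun y => u y ^ p)
      (ContinuousLinearMap.mul ℝ ℝ) MeasureTheory.volume
  /-- The differential inequality holds pointwise. -/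
  inequality : ∀ x,
    (logRieszKernel N α β ⋆[ContinuousLinearMap.mul ℝ ℝ, MeasureTheory.volume]
        (fun y => u y ^ p)) x * u x ^ q ≤
      Laplacian.laplacian (Laplacian.laplacian u) x - lam * Laplacian.laplacian u x

end

section

open Laplacian Filter Topology MeasureTheory

/-! ### Laplacian calculus and a minimum principle. -/

section LaplacianToolkit

/-! With v = λu - Δu the inequality reads -Δv ≥ (K*u^p) u^q, a second order problem for v coupled
with the resolvent equation for u.

Necessity. Away from the origin K is at least a multiple of |z|^(-N), so finiteness of K*u^p bounds
the averages of u^p, hence of u, over large balls. In weighted averages of v over balls of radius R,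
the term Δu is O(R^(-2)) after integration by parts; since v is superharmonic it dominates these
averages, and R → ∞ gives v ≥ 0 (`sub_laplacian_nonneg_of_bounded_averages`). Then v ≥ m₀ > 0 on
some ball. Let m be the minimum of v on the ball of radius R about its centre c. Comparison with the
fundamental solution (`mul_rpow_le_of_superharmonic`) gives m ≥ C R^(-(N-2)) and v ≥ κm on the ball
of radius 8R. The resolvent equation passes this to u ≥ κ'm at radius 5R, whence K*u^p ≥ C m^p
log^β(1+R) at radius 2R, and a quadratic barrier for -Δv ≥ C m^(p+q) log^β(1+R) returns m ≥ C R²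
m^(p+q) log^β(1+R). Together, log^β(1+R) ≤ C R^((N-2)(p+q-1)-2), which is bounded if p+q ≤ N/(N-2).
The logarithm thus excludes equality as well.

Sufficiency. Take u = ε(1+|x|²)^(-a/2) with 2/(p+q-1) < a < N-2. For λ large the left side is at
least ε(1+|x|²)^(-a/2-1), because -λΔu dominates the faster decaying Δ²u. The convolution loses an
arbitrarily small power of decay to the logarithm, and the choice of a leaves room for that; ε then
absorbs the constant. -/

theorem contDiffAt_rpow_add_norm_sq {E : Type*} [NormedAddCommGroup E]
    [InnerProductSpace ℝ E] {k s : ℝ} {c x : E} {n : WithTop ℕ∞}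
    (hx : 0 < k + ‖x - c‖ ^ 2) :
    ContDiffAt ℝ n (fun y : E => (k + ‖y - c‖ ^ 2) ^ s) x := by
  refine ContDiffAt.rpow_const_of_ne ?_ hx.ne'
  exact contDiffAt_const.add ((contDiffAt_id.sub contDiffAt_const).norm_sq ℝ)

variable {E : Type*} [NormedAddCommGroup E] [InnerProductSpace ℝ E] [FiniteDimensional ℝ E]

theorem laplacian_eq_sum_fderiv_fderiv {ι : Type*} [Fintype ι] (b : OrthonormalBasis ι ℝ E)
    (f : E → ℝ) (x : E) :
    Δ f x = ∑ i, fderiv ℝ (fderiv ℝ f) x (b i) (b i) := by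
  rw [InnerProductSpace.laplacian_eq_iteratedFDeriv_orthonormalBasis f b]
  simp [iteratedFDeriv_two_apply]

theorem ContDiff.laplacian {f : E → ℝ} {m n : WithTop ℕ∞} (hf : ContDiff ℝ n f)
    (hmn : m + 1 + 1 ≤ n) : ContDiff ℝ m (Δ f) := by
  have h2 : ContDiff ℝ m (fderiv ℝ (fderiv ℝ f)) := (hf.fderiv_right hmn).fderiv_right le_rfl
  have : Δ f = fun x => ∑ i, fderiv ℝ (fderiv ℝ f) x (stdOrthonormalBasis ℝ E i)
      (stdOrthonormalBasis ℝ E i) := by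
    ext x
    exact laplacian_eq_sum_fderiv_fderiv _ f x
  rw [this]
  fun_prop

/-- The second derivative of a real function is non-negative at a local minimum. -/
theorem IsLocalMin.deriv_deriv_nonneg {g : ℝ → ℝ} {t : ℝ} (h : IsLocalMin g t)
    (hc : ContinuousAt g t) : 0 ≤ deriv (deriv g) t := by
  by_contra! hlt
  -- A negative second derivative would make t a local maximum too, so g would be constant near t
  -- and its second derivative 0.
  have hmax := isLocalMax_of_deriv_deriv_neg hlt h.deriv_eq_zero hc
  have hconst : g =ᶠ[𝓝 t] fun _ => g t := by
    filter_upwards [h, hmax] with s h1 h2 using le_antisymm h2 h1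
  have := hconst.deriv.deriv_eq
  simp at this
  exact hlt.ne this

/-- The Laplacian is non-negative at a local minimum. -/
theorem IsLocalMin.laplacian_nonneg {f : E → ℝ} {x : E} (h : IsLocalMin f x)
    (hf : ContDiffAt ℝ 2 f x) : 0 ≤ Δ f x := by
  rw [laplacian_eq_sum_fderiv_fderiv (stdOrthonormalBasis ℝ E)]
  refine Finset.sum_nonneg fun i _ => ?_
  set e := stdOrthonormalBasis ℝ E i
  let l : ℝ → E := fun t => x + t • e
  have hl0 : l 0 = x := by simp [l]
  have hl : ∀ t, HasDerivAt l e t := fun t => by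
    simpa [l] using ((hasDerivAt_id t).smul_const e).const_add x
  have hlc : Tendsto l (𝓝 0) (𝓝 x) := by
    have := (hl 0).continuousAt
    rwa [ContinuousAt, hl0] at this
  have hd : ∀ᶠ t in 𝓝 (0 : ℝ), deriv (f ∘ l) t = fderiv ℝ f (l t) e := by
    have hev : ∀ᶠ y in 𝓝 x, ContDiffAt ℝ 2 f y := hf.eventually (by simp)
    filter_upwards [hlc.eventually hev] with t ht
    exact ((ht.differentiableAt (by simp)).hasFDerivAt.comp_hasDerivAt t (hl t)).deriv
  have hdd : deriv (deriv (f ∘ l)) 0 = fderiv ℝ (fderiv ℝ f) x e e := by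
    rw [EventuallyEq.deriv_eq hd]
    have h1 : HasFDerivAt (fderiv ℝ f) (fderiv ℝ (fderiv ℝ f) x) (l 0) := by
      rw [hl0]
      exact ((hf.fderiv_right (m := 1) (by norm_num)).differentiableAt (by simp)).hasFDerivAt
    exact ((h1.comp_hasDerivAt (0 : ℝ) (hl 0)).clm_apply (hasDerivAt_const (0 : ℝ) e)).deriv.trans
      (by simp)
  rw [← hdd]
  apply IsLocalMin.deriv_deriv_nonneg
  · have := hlc.eventually h
    simpa [IsLocalMin, IsMinFilter, hl0] using this
  · have hfc : ContinuousAt f (l 0) := by rw [hl0]; exact hf.continuousAt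
    exact hfc.comp (hl 0).continuousAt

/-- A minimum principle on a compact set. -/
theorem IsCompact.nonneg_of_laplacian_neg {K : Set E} (hK : IsCompact K) {w : E → ℝ}
    (hw : ContinuousOn w K)
    (h : ∀ x ∈ K, w x < 0 → K ∈ 𝓝 x ∧ ContDiffAt ℝ 2 w x ∧ Δ w x < 0) :
    ∀ x ∈ K, 0 ≤ w x := by
  intro x hx
  obtain ⟨z, hz, hmin⟩ := hK.exists_isMinOn ⟨x, hx⟩ hw
  by_contra! hneg
  obtain ⟨h1, h2, h3⟩ := h z hz ((hmin hx).trans_lt hneg)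
  exact h3.not_ge ((hmin.isLocalMin h1).laplacian_nonneg h2)

/-- The Laplacian of a function of the squared distance to a point. -/
theorem laplacian_comp_norm_sq {g g₁ : ℝ → ℝ} {g₂ : ℝ} {c x : E}
    (h1 : ∀ᶠ t in 𝓝 (‖x - c‖ ^ 2), HasDerivAt g (g₁ t) t)
    (h2 : HasDerivAt g₁ g₂ (‖x - c‖ ^ 2)) :
    Δ (fun y => g (‖y - c‖ ^ 2)) x =
      4 * ‖x - c‖ ^ 2 * g₂ + 2 * Module.finrank ℝ E * g₁ (‖x - c‖ ^ 2) := by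
  rw [laplacian_eq_sum_fderiv_fderiv (stdOrthonormalBasis ℝ E)]
  have hn : ∀ y : E, HasFDerivAt (fun y : E => ‖y - c‖ ^ 2) (2 • innerSL ℝ (y - c)) y := by
    intro y
    have := ((hasFDerivAt_id y).sub_const c).norm_sq
    simpa using this
  have hcont : Tendsto (fun y : E => ‖y - c‖ ^ 2) (𝓝 x) (𝓝 (‖x - c‖ ^ 2)) :=
    (hn x).continuousAt
  have hd : fderiv ℝ (fun y => g (‖y - c‖ ^ 2)) =ᶠ[𝓝 x]
      fun y => g₁ (‖y - c‖ ^ 2) • ((2 : ℝ) • innerSL ℝ (y - c)) := by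
    filter_upwards [hcont.eventually h1] with y hy
    refine (hy.comp_hasFDerivAt y (hn y)).fderiv.trans ?_
    ext z; simp
  have hin : HasFDerivAt (fun y : E => (2 : ℝ) • innerSL ℝ (y - c)) ((2 : ℝ) • innerSL ℝ) x := by
    have : HasFDerivAt (fun y : E => innerSL ℝ (y - c)) (innerSL ℝ) x :=
      ((innerSL ℝ (E := E)).hasFDerivAt.comp x ((hasFDerivAt_id x).sub_const c))
    exact this.const_smul (2 : ℝ)
  have hdd := (h2.comp_hasFDerivAt x (hn x)).smul hin
  have := hd.fderiv_eq.trans hdd.fderiv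
  have key := (stdOrthonormalBasis ℝ E).sum_sq_inner_right (x - c)
  have hterm : ∀ i, fderiv ℝ (fderiv ℝ fun y => g (‖y - c‖ ^ 2)) x
        (stdOrthonormalBasis ℝ E i) (stdOrthonormalBasis ℝ E i) =
      2 * g₁ (‖x - c‖ ^ 2) + 4 * g₂ * inner ℝ (stdOrthonormalBasis ℝ E i) (x - c) ^ 2 := by
    intro i
    have h1 : innerSL ℝ (stdOrthonormalBasis ℝ E i) (stdOrthonormalBasis ℝ E i) = (1 : ℝ) := by
      rw [innerSL_apply_apply, real_inner_self_eq_norm_sq, OrthonormalBasis.norm_eq_one, one_pow]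
    have h2 : innerSL ℝ (x - c) (stdOrthonormalBasis ℝ E i) =
        inner ℝ (stdOrthonormalBasis ℝ E i) (x - c) := by
      rw [innerSL_apply_apply, real_inner_comm]
    rw [this]
    simp [-map_sub, h1, h2]
    ring
  refine (Finset.sum_congr rfl fun i _ => hterm i).trans ?_
  rw [Finset.sum_add_distrib, ← Finset.mul_sum (a := 4 * g₂), key]
  simp
  ring

/-- The first coefficient vanishes at the fundamental exponent s = (n-2)/2, where the sign of k
alone decides: k < 0 gives the strictly subharmonic barrier of the comparison, while k = 1 gives the
global smooth profile of the construction. -/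
theorem laplacian_rpow_add_norm_sq {k s : ℝ} {c x : E} (hx : 0 < k + ‖x - c‖ ^ 2) :
    Δ (fun y : E => (k + ‖y - c‖ ^ 2) ^ (-s)) x =
      -(2 * s * ((Module.finrank ℝ E : ℝ) - 2 - 2 * s)) * (k + ‖x - c‖ ^ 2) ^ (-(s + 1))
        - 4 * s * (s + 1) * k * (k + ‖x - c‖ ^ 2) ^ (-(s + 2)) := by
  have hd : ∀ r t : ℝ, 0 < k + t → HasDerivAt (fun t => (k + t) ^ r) (r * (k + t) ^ (r - 1)) t := by
    intro r t ht
    have := ((hasDerivAt_id t).const_add k).rpow_const (p := r) (Or.inl ht.ne')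
    simpa using this
  rw [laplacian_comp_norm_sq (g := fun t => (k + t) ^ (-s))
    (g₁ := fun t => (-s) * (k + t) ^ (-s - 1))
    (g₂ := (-s) * ((-s - 1) * (k + ‖x - c‖ ^ 2) ^ (-s - 1 - 1)))]
  · have e1 : (k + ‖x - c‖ ^ 2) ^ (-(s + 1)) =
        (k + ‖x - c‖ ^ 2) * (k + ‖x - c‖ ^ 2) ^ (-(s + 2)) := by
      rw [show -(s + 1) = 1 + -(s + 2) by ring, Real.rpow_add hx, Real.rpow_one]
    rw [show -s - 1 - 1 = -(s + 2) by ring, show -s - 1 = -(s + 1) by ring, e1]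
    ring
  · have : ∀ᶠ t in 𝓝 (‖x - c‖ ^ 2), 0 < k + t :=
      (continuous_const.add continuous_id).continuousAt.eventually (lt_mem_nhds hx)
    filter_upwards [this] with t ht using hd _ t ht
  · exact (hd _ _ hx).const_mul _

theorem laplacian_comp_add_smul {f : E → ℝ} (hf : ContDiff ℝ 2 f) (a x : E) (r : ℝ) :
    Δ (fun y => f (a + r • y)) x = r ^ 2 * Δ f (a + r • x) := by
  have h1 : ∀ y, HasFDerivAt (fun y : E => a + r • y) (r • ContinuousLinearMap.id ℝ E) y := fun y => by
    simpa using ((hasFDerivAt_id y).const_smul r).const_add a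
  have h2 : fderiv ℝ (fun y => f (a + r • y)) = fun y => r • fderiv ℝ f (a + r • y) := by
    ext y z
    have := ((hf.differentiable (by simp) (a + r • y)).hasFDerivAt.comp y (h1 y)).fderiv
    rw [show fderiv ℝ (fun y => f (a + r • y)) y = _ from this]
    simp
  have h3 : fderiv ℝ (fun y => r • fderiv ℝ f (a + r • y)) x =
      r • ((fderiv ℝ (fderiv ℝ f) (a + r • x)).comp (r • ContinuousLinearMap.id ℝ E)) := by
    have hd : Differentiable ℝ (fderiv ℝ f) :=
      (hf.fderiv_right (m := 1) (by norm_num)).differentiable (by simp)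
    exact (((hd (a + r • x)).hasFDerivAt.comp x (h1 x)).const_smul r).fderiv
  rw [laplacian_eq_sum_fderiv_fderiv (stdOrthonormalBasis ℝ E),
    laplacian_eq_sum_fderiv_fderiv (stdOrthonormalBasis ℝ E), h2, h3, Finset.mul_sum]
  refine Finset.sum_congr rfl fun i _ => ?_
  simp
  ring

end LaplacianToolkit

/-! ### Green's identities with a compactly supported factor. -/

section IntegrationByParts

variable {E : Type*} [NormedAddCommGroup E] [InnerProductSpace ℝ E] [FiniteDimensional ℝ E]
  [MeasurableSpace E] [BorelSpace E] (μ : Measure E) [μ.IsAddHaarMeasure]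

theorem integral_fderiv_mul_eq_neg_of_hasCompactSupport {f ψ : E → ℝ} (hf : ContDiff ℝ 1 f)
    (hψ : ContDiff ℝ 1 ψ) (hs : HasCompactSupport ψ) (b : E) :
    ∫ x, fderiv ℝ f x b * ψ x ∂μ = -∫ x, f x * fderiv ℝ ψ x b ∂μ := by
  have hf' : Continuous fun x => fderiv ℝ f x b :=
    (hf.continuous_fderiv (by simp)).clm_apply continuous_const
  have hψ' : Continuous fun x => fderiv ℝ ψ x b :=
    (hψ.continuous_fderiv (by simp)).clm_apply continuous_const
  have := integral_mul_fderiv_eq_neg_fderiv_mul_of_integrable (μ := μ) (f := f) (g := ψ) (v := b)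
    ((hf'.mul hψ.continuous).integrable_of_hasCompactSupport hs.mul_left)
    ((hf.continuous.mul hψ').integrable_of_hasCompactSupport (hs.fderiv_apply ℝ b).mul_left)
    ((hf.continuous.mul hψ.continuous).integrable_of_hasCompactSupport hs.mul_left)
    (fun x _ => hf.differentiable (by simp) x) (fun x _ => hψ.differentiable (by simp) x)
  rw [this, neg_neg]

theorem integral_laplacian_mul_eq_neg_sum {f ψ : E → ℝ} (hf : ContDiff ℝ 2 f)
    (hψ : ContDiff ℝ 1 ψ) (hs : HasCompactSupport ψ) {ι : Type*} [Fintype ι]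
    (b : OrthonormalBasis ι ℝ E) :
    ∫ x, Δ f x * ψ x ∂μ = -∑ i, ∫ x, fderiv ℝ f x (b i) * fderiv ℝ ψ x (b i) ∂μ := by
  have hf1 : ContDiff ℝ 1 (fderiv ℝ f) := hf.fderiv_right (by norm_num)
  have hc : ∀ i, ContDiff ℝ 1 fun x => fderiv ℝ f x (b i) := fun i =>
    hf1.clm_apply contDiff_const
  have hcc : ∀ i x, fderiv ℝ (fun x => fderiv ℝ f x (b i)) x (b i) =
      fderiv ℝ (fderiv ℝ f) x (b i) (b i) := by
    intro i x
    rw [fderiv_clm_apply (hf1.differentiable (by simp) x) (by fun_prop)]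
    simp
  have hint : ∀ i, Integrable (fun x => fderiv ℝ (fun x => fderiv ℝ f x (b i)) x (b i) * ψ x) μ := by
    intro i
    have := ((hc i).continuous_fderiv (by simp)).clm_apply (continuous_const (y := b i))
    exact (this.mul hψ.continuous).integrable_of_hasCompactSupport hs.mul_left
  simp_rw [laplacian_eq_sum_fderiv_fderiv b f, ← hcc, Finset.sum_mul]
  rw [integral_finsetSum _ fun i _ => hint i, ← Finset.sum_neg_distrib]
  exact Finset.sum_congr rfl fun i _ =>
    integral_fderiv_mul_eq_neg_of_hasCompactSupport μ (hc i) hψ hs (b i)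

theorem integral_laplacian_mul_eq {f ψ : E → ℝ} (hf : ContDiff ℝ 2 f)
    (hψ : ContDiff ℝ 2 ψ) (hs : HasCompactSupport ψ) :
    ∫ x, Δ f x * ψ x ∂μ = ∫ x, f x * Δ ψ x ∂μ := by
  have b := stdOrthonormalBasis ℝ E
  have hψ1 : ContDiff ℝ 1 (fderiv ℝ ψ) := hψ.fderiv_right (by norm_num)
  have hc : ∀ i, ContDiff ℝ 1 fun x => fderiv ℝ ψ x (b i) := fun i =>
    hψ1.clm_apply contDiff_const
  have hcc : ∀ i x, fderiv ℝ (fun x => fderiv ℝ ψ x (b i)) x (b i) =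
      fderiv ℝ (fderiv ℝ ψ) x (b i) (b i) := by
    intro i x
    rw [fderiv_clm_apply (hψ1.differentiable (by simp) x) (by fun_prop)]
    simp
  have hint : ∀ i, Integrable (fun x => f x * fderiv ℝ (fun x => fderiv ℝ ψ x (b i)) x (b i)) μ := by
    intro i
    have := ((hc i).continuous_fderiv (by simp)).clm_apply (continuous_const (y := b i))
    exact (hf.continuous.mul this).integrable_of_hasCompactSupport
      ((hs.fderiv_apply ℝ (b i)).fderiv_apply ℝ (b i)).mul_left
  rw [integral_laplacian_mul_eq_neg_sum μ hf (hψ.of_le (by norm_num)) hs b]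
  simp_rw [laplacian_eq_sum_fderiv_fderiv b ψ, ← hcc, Finset.mul_sum]
  rw [integral_finsetSum _ fun i _ => hint i, ← Finset.sum_neg_distrib]
  refine Finset.sum_congr rfl fun i _ => ?_
  rw [integral_fderiv_mul_eq_neg_of_hasCompactSupport μ (hf.of_le (by norm_num)) (hc i)
    (hs.fderiv_apply ℝ (b i)), neg_neg]

end IntegrationByParts

/-! ### Smooth weighted mean value inequality for superharmonic functions. -/

section SuperMeanValue

/-- A non-negative radial weight `φ` together with a potential `Ψ` of `y ↦ -φ y • y`. -/
theorem exists_radial_weight (E : Type*) [NormedAddCommGroup E] [InnerProductSpace ℝ E]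
    [FiniteDimensional ℝ E] [Nontrivial E] :
    ∃ Ψ φ : E → ℝ, ContDiff ℝ 2 Ψ ∧ ContDiff ℝ 2 φ ∧ HasCompactSupport Ψ ∧ HasCompactSupport φ ∧
      (∀ y, 0 ≤ Ψ y) ∧ (∀ y, 0 ≤ φ y) ∧ (∃ y, φ y ≠ 0) ∧
      ∀ y b, fderiv ℝ Ψ y b = -(φ y * inner ℝ y b) := by
  -- A smooth antitone cutoff, 1 for t ≤ 1 and 0 for t ≥ 2. The pair is Ψ = G(|y|²) and φ =
  -- -2G'(|y|²), so ∇Ψ = -φ y and φ ≥ 0.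
  let G : ℝ → ℝ := fun t => Real.smoothTransition (2 - t)
  have hG : ∀ n : ℕ∞, ContDiff ℝ n G := fun n =>
    Real.smoothTransition.contDiff.comp (contDiff_const.sub contDiff_id)
  have hG0 : ∀ t, 2 ≤ t → G t = 0 := fun t ht =>
    Real.smoothTransition.zero_of_nonpos (by linarith)
  have hGanti : Antitone G := fun s t hst =>
    Real.smoothTransition.monotone (by linarith)
  have hG' : ContDiff ℝ 2 (deriv G) :=
    (contDiff_succ_iff_deriv.1 ((hG 3).of_le (m := 2 + 1) (by norm_num))).2.2
  have hG'0 : ∀ t, 2 < t → deriv G t = 0 := by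
    intro t ht
    have : G =ᶠ[𝓝 t] fun _ => 0 := by
      filter_upwards [lt_mem_nhds ht] with s hs using hG0 s hs.le
    simp [this.deriv_eq]
  have hsupp : ∀ H : ℝ → ℝ, (∀ t, 2 < t → H t = 0) →
      HasCompactSupport (fun y : E => H (‖y‖ ^ 2)) := by
    intro H hH
    refine HasCompactSupport.intro (isCompact_closedBall 0 2) fun y hy => hH _ ?_
    have : 2 < ‖y‖ := by simpa using hy
    nlinarith
  have hsq : ∀ n : ℕ∞, ContDiff ℝ n fun y : E => ‖y‖ ^ 2 := fun n => contDiff_norm_sq ℝ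
  refine ⟨fun y => G (‖y‖ ^ 2), fun y => -2 * deriv G (‖y‖ ^ 2), (hG 2).comp (hsq 2),
    contDiff_const.mul (hG'.comp (hsq 2)), hsupp G fun t ht => hG0 t ht.le,
    hsupp (fun t => -2 * deriv G t) fun t ht => by simp [hG'0 t ht],
    fun y => Real.smoothTransition.nonneg _, fun y => ?_, ?_, fun y b => ?_⟩
  · have := hGanti.deriv_nonpos (x := ‖y‖ ^ 2)
    linarith
  · have hdiff : Differentiable ℝ G := (hG 1).differentiable (by simp)
    obtain ⟨t, ht, ht'⟩ := exists_deriv_eq_slope G (show (1 : ℝ) < 2 by norm_num)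
      hdiff.continuous.continuousOn hdiff.differentiableOn
    obtain ⟨y, hy⟩ := exists_norm_eq E (Real.sqrt_nonneg t)
    refine ⟨y, ?_⟩
    simp only
    have h1 : G 1 = 1 := Real.smoothTransition.one_of_one_le (by norm_num)
    rw [hG0 2 le_rfl, h1] at ht'
    rw [hy, Real.sq_sqrt (by linarith [ht.1]), ht']
    norm_num
  · have h1 : HasFDerivAt (fun y : E => ‖y‖ ^ 2) (2 • innerSL ℝ y) y := by
      simpa using (hasFDerivAt_id y).norm_sq
    have h2 : HasDerivAt G (deriv G (‖y‖ ^ 2)) (‖y‖ ^ 2) :=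
      ((hG 1).differentiable (by simp) _).hasDerivAt
    have := (h2.comp_hasFDerivAt y h1).fderiv
    rw [show fderiv ℝ (fun y : E => G (‖y‖ ^ 2)) y = _ from this]
    simp
    ring

theorem hasDerivAt_integral_dilation {E : Type*} [NormedAddCommGroup E] [NormedSpace ℝ E]
    [MeasurableSpace E] [BorelSpace E] (μ : Measure E) [IsFiniteMeasureOnCompacts μ] {v φ : E → ℝ} (hv : ContDiff ℝ 1 v)
    (hφ : Continuous φ) (hs : HasCompactSupport φ) (x : E) (R : ℝ) :
    HasDerivAt (fun R : ℝ => ∫ y, v (x + R • y) * φ y ∂μ)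
      (∫ y, fderiv ℝ v (x + R • y) y * φ y ∂μ) R := by
  have hcF : ∀ r : ℝ, Continuous fun y => v (x + r • y) * φ y := fun r => by
    have := hv.continuous
    fun_prop
  have hcd : Continuous fun z : ℝ × E => fderiv ℝ v (x + z.1 • z.2) z.2 := by
    have := hv.continuous_fderiv (by simp)
    exact (this.comp (by fun_prop)).clm_apply continuous_snd
  have hcF' : Continuous fun z : ℝ × E => fderiv ℝ v (x + z.1 • z.2) z.2 * φ z.2 :=
    hcd.mul (hφ.comp continuous_snd)
  -- For r within 1 of R and y in the support of φ the derivative stays on a compact set; this bound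
  -- dominates the integrand.
  obtain ⟨C, hC⟩ := ((isCompact_closedBall R 1).prod hs).exists_bound_of_continuousOn
    hcd.continuousOn
  refine (hasDerivAt_integral_of_dominated_loc_of_deriv_le
    (bound := fun y => C * ‖φ y‖) (F := fun (r : ℝ) y => v (x + r • y) * φ y)
    (F' := fun (r : ℝ) y => fderiv ℝ v (x + r • y) y * φ y)
    (Metric.closedBall_mem_nhds R one_pos)
    (Eventually.of_forall fun r => (hcF r).aestronglyMeasurable)
    ((hcF R).integrable_of_hasCompactSupport hs.mul_left)
    (hcF'.comp (Continuous.prodMk_right R)).aestronglyMeasurable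
    (Eventually.of_forall fun y r hr => ?_)
    ((hφ.norm.integrable_of_hasCompactSupport hs.norm).const_mul C)
    (Eventually.of_forall fun y r hr => ?_)).2
  · by_cases hy : y ∈ tsupport φ
    · rw [norm_mul]
      exact mul_le_mul_of_nonneg_right (hC (r, y) ⟨hr, hy⟩) (norm_nonneg _)
    · simp [image_eq_zero_of_notMem_tsupport hy]
  · have h1 : HasDerivAt (fun r : ℝ => x + r • y) y r := by
      simpa using ((hasDerivAt_id r).smul_const y).const_add x
    exact (((hv.differentiable (by simp) _).hasFDerivAt).comp_hasDerivAt r h1).mul_const _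

variable {E : Type*} [NormedAddCommGroup E] [InnerProductSpace ℝ E] [FiniteDimensional ℝ E]
  [MeasurableSpace E] [BorelSpace E] (μ : Measure E) [μ.IsAddHaarMeasure]

/-- Weighted averages of a superharmonic function over dilated balls are at most the value at
the centre. -/
theorem integral_dilation_le_of_laplacian_nonpos {v Ψ φ : E → ℝ} (hv : ContDiff ℝ 2 v)
    (hΔ : ∀ x, Δ v x ≤ 0) (hΨ : ContDiff ℝ 2 Ψ) (hφ : Continuous φ) (hΨs : HasCompactSupport Ψ)
    (hφs : HasCompactSupport φ) (hΨ0 : ∀ y, 0 ≤ Ψ y)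
    (hΨφ : ∀ y b, fderiv ℝ Ψ y b = -(φ y * inner ℝ y b)) (x : E) {R : ℝ} (hR : 0 ≤ R) :
    ∫ y, v (x + R • y) * φ y ∂μ ≤ v x * ∫ y, φ y ∂μ := by
  have hd := hasDerivAt_integral_dilation μ (hv.of_le (by norm_num)) hφ hφs x
  have hanti : AntitoneOn (fun R : ℝ => ∫ y, v (x + R • y) * φ y ∂μ) (Set.Ici 0) := by
    refine antitoneOn_of_deriv_nonpos (convex_Ici 0)
      (fun r _ => (hd r).continuousAt.continuousWithinAt)
      (fun r _ => (hd r).differentiableAt.differentiableWithinAt) fun r hr => ?_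
    have hr : 0 < r := by simpa using hr
    rw [(hd r).deriv]
    let b := stdOrthonormalBasis ℝ E
    let w : E → ℝ := fun y => v (x + r • y)
    have hw : ContDiff ℝ 2 w := hv.comp (contDiff_const.add (contDiff_const.smul contDiff_id))
    have hwf : ∀ y z, fderiv ℝ w y z = r * fderiv ℝ v (x + r • y) z := by
      intro y z
      have h1 : HasFDerivAt (fun y : E => x + r • y) (r • ContinuousLinearMap.id ℝ E) y := by
        simpa using ((hasFDerivAt_id y).const_smul r).const_add x
      have := ((hv.differentiable (by simp) (x + r • y)).hasFDerivAt.comp y h1).fderiv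
      rw [show fderiv ℝ w y = _ from this]
      simp
    have hint : ∀ i, Integrable (fun y => fderiv ℝ w y (b i) * fderiv ℝ Ψ y (b i)) μ := by
      intro i
      have h1 := (hw.continuous_fderiv (by simp)).clm_apply (continuous_const (y := b i))
      have h2 := (hΨ.continuous_fderiv (by simp)).clm_apply (continuous_const (y := b i))
      exact (h1.mul h2).integrable_of_hasCompactSupport (hΨs.fderiv_apply ℝ (b i)).mul_left
    have hsum : ∀ y, r * (fderiv ℝ v (x + r • y) y * φ y) =
        -∑ i, fderiv ℝ w y (b i) * fderiv ℝ Ψ y (b i) := by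
      intro y
      have hy : ∀ T : E →L[ℝ] ℝ, T y = ∑ i, inner ℝ y (b i) * T (b i) := by
        intro T
        conv_lhs => rw [← b.sum_repr' y]
        simp [real_inner_comm]
      rw [← mul_assoc, ← hwf, hy (fderiv ℝ w y), Finset.sum_mul, ← Finset.sum_neg_distrib]
      refine Finset.sum_congr rfl fun i _ => ?_
      rw [hΨφ]
      ring
    -- The r-derivative of the average tests ∇v against φ y = -∇Ψ, so integrating by parts gives the
    -- integral of Δw against Ψ ≥ 0, which is non-positive.
    have hkey : r * ∫ y, fderiv ℝ v (x + r • y) y * φ y ∂μ = ∫ y, Δ w y * Ψ y ∂μ := by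
      rw [integral_laplacian_mul_eq_neg_sum μ hw (hΨ.of_le (by norm_num)) hΨs b,
        ← integral_finsetSum _ fun i _ => hint i, ← integral_neg, ← integral_const_mul]
      exact integral_congr_ae (Eventually.of_forall hsum)
    have hle : ∫ y, Δ w y * Ψ y ∂μ ≤ 0 := by
      refine integral_nonpos fun y => mul_nonpos_of_nonpos_of_nonneg ?_ (hΨ0 y)
      rw [laplacian_comp_add_smul hv]
      exact mul_nonpos_of_nonneg_of_nonpos (sq_nonneg r) (hΔ _)
    rw [← hkey] at hle
    exact nonpos_of_mul_nonpos_right hle hr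
  have := hanti (Set.mem_Ici.2 le_rfl) (Set.mem_Ici.2 hR) hR
  simpa [integral_const_mul] using this

end SuperMeanValue

/-! ### Lower bounds for the kernel, and averages over large balls. -/

section KernelBounds

variable {N : ℕ}

theorem logRieszKernel_neg (α β : ℝ) (x : EuclideanSpace ℝ (Fin N)) :
    logRieszKernel N α β (-x) = logRieszKernel N α β x := by
  simp [logRieszKernel]

theorem logRieszKernel_nonneg (α β : ℝ) (x : EuclideanSpace ℝ (Fin N)) :
    0 ≤ logRieszKernel N α β x :=
  mul_nonneg (Real.rpow_nonneg (norm_nonneg _) _)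
    (Real.rpow_nonneg (Real.log_nonneg (by linarith [norm_nonneg x])) _)

/-- On an annulus the decreasing power is smallest at the outer radius and the increasing logarithm
at the inner one. -/
theorem le_logRieszKernel {α β r R : ℝ} (hα : 0 ≤ α) (hβ : 0 ≤ β) (hr : 0 < r)
    {x : EuclideanSpace ℝ (Fin N)} (h1 : r ≤ ‖x‖) (h2 : ‖x‖ ≤ R) :
    R ^ (-α) * Real.log (1 + r) ^ β ≤ logRieszKernel N α β x := by
  have hx : 0 < ‖x‖ := hr.trans_le h1
  have hl : 0 ≤ Real.log (1 + r) := Real.log_nonneg (by linarith)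
  refine mul_le_mul (Real.rpow_le_rpow_of_nonpos hx h2 (by linarith)) ?_
    (Real.rpow_nonneg hl _) (Real.rpow_nonneg hx.le _)
  exact Real.rpow_le_rpow hl (Real.log_le_log (by linarith) (by linarith)) hβ

/-- Integrability against the kernel bounds the averages over large balls. -/
theorem exists_setIntegral_dilation_le {β : ℝ} (hβ : 0 ≤ β)
    {U : EuclideanSpace ℝ (Fin N) → ℝ} (hU : Continuous U) (hU0 : ∀ x, 0 ≤ U x)
    {x : EuclideanSpace ℝ (Fin N)}
    (hint : Integrable fun z => logRieszKernel N N β z * U (x + z)) {ρ : ℝ} (hρ : 0 < ρ) :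
    ∃ C, ∀ R : ℝ, 1 ≤ R →
      ∫ y in Metric.closedBall (0 : EuclideanSpace ℝ (Fin N)) ρ, U (x + R • y) ≤ C := by
  set L := Real.log 2 ^ β
  have hL : 0 < L := Real.rpow_pos_of_pos (Real.log_pos (by norm_num)) _
  set I := ∫ z, logRieszKernel N N β z * U (x + z)
  set J := ∫ z in Metric.closedBall (0 : EuclideanSpace ℝ (Fin N)) 1, U (x + z)
  have hJ : 0 ≤ J := integral_nonneg fun z => hU0 _
  have hUx : Continuous fun z => U (x + z) := by fun_prop
  -- For 1 ≤ |z| ≤ Rρ the kernel is at least L(Rρ)^(-N), and the Jacobian R^(-N) of the dilation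
  -- cancels the R^N so produced. Inside the unit ball the kernel need not have a positive lower
  -- bound, so that part is kept as J.
  refine ⟨J + ρ ^ N / L * I, fun R hR => ?_⟩
  have hR0 : 0 < R := by linarith
  have hscale := Measure.setIntegral_comp_smul_of_pos (volume : Measure (EuclideanSpace ℝ (Fin N)))
    (fun z => U (x + z)) (Metric.closedBall 0 ρ) hR0
  rw [hscale, smul_closedBall _ _ hρ.le, smul_zero, finrank_euclideanSpace_fin, smul_eq_mul,
    Real.norm_of_nonneg hR0.le]
  set B := Metric.closedBall (0 : EuclideanSpace ℝ (Fin N)) (R * ρ)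
  have hB : MeasurableSet B := measurableSet_closedBall
  have hind : Integrable ((Metric.closedBall (0 : EuclideanSpace ℝ (Fin N)) 1).indicator
      fun z => U (x + z)) :=
    (integrable_indicator_iff measurableSet_closedBall).2
      (hUx.continuousOn.integrableOn_compact (isCompact_closedBall _ _))
  have hRρ : 0 ≤ (R * ρ) ^ N / L := by positivity
  have hpt : ∀ z ∈ B, U (x + z) ≤
      (Metric.closedBall (0 : EuclideanSpace ℝ (Fin N)) 1).indicator (fun z => U (x + z)) z +
        (R * ρ) ^ N / L * (logRieszKernel N N β z * U (x + z)) := by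
    intro z hz
    by_cases h1 : z ∈ Metric.closedBall (0 : EuclideanSpace ℝ (Fin N)) 1
    · rw [Set.indicator_of_mem h1]
      have := mul_nonneg hRρ (mul_nonneg (logRieszKernel_nonneg (N : ℝ) β z) (hU0 (x + z)))
      linarith
    · rw [Set.indicator_of_notMem h1, zero_add, ← mul_assoc]
      refine le_mul_of_one_le_left (hU0 _) ?_
      have h1' : 1 ≤ ‖z‖ := by
        simp only [Metric.mem_closedBall, dist_zero_right, not_le] at h1
        exact h1.le
      have hz' : ‖z‖ ≤ R * ρ := by simpa [B] using hz
      have hk := le_logRieszKernel (N := N) (α := N) (Nat.cast_nonneg N) hβ one_pos h1' hz'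
      have hp : 0 < R * ρ := by positivity
      rw [Real.rpow_neg hp.le, Real.rpow_natCast, one_add_one_eq_two] at hk
      have hpN : 0 < (R * ρ) ^ N := by positivity
      calc (1 : ℝ) = (R * ρ) ^ N / L * (((R * ρ) ^ N)⁻¹ * L) := by field_simp
        _ ≤ _ := by gcongr
  have hle : ∫ z in B, U (x + z) ≤ J + (R * ρ) ^ N / L * I := by
    calc ∫ z in B, U (x + z) ≤ ∫ z in B,
          ((Metric.closedBall (0 : EuclideanSpace ℝ (Fin N)) 1).indicator (fun z => U (x + z)) z +
            (R * ρ) ^ N / L * (logRieszKernel N N β z * U (x + z))) :=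
          setIntegral_mono_on (hUx.continuousOn.integrableOn_compact (isCompact_closedBall _ _))
            (hind.add (hint.const_mul _)).integrableOn hB hpt
      _ ≤ ∫ z, ((Metric.closedBall (0 : EuclideanSpace ℝ (Fin N)) 1).indicator
            (fun z => U (x + z)) z +
            (R * ρ) ^ N / L * (logRieszKernel N N β z * U (x + z))) := by
          refine setIntegral_le_integral (hind.add (hint.const_mul _))
            (Eventually.of_forall fun z => ?_)
          exact add_nonneg (Set.indicator_nonneg (fun _ _ => hU0 _) _)
            (mul_nonneg hRρ (mul_nonneg (logRieszKernel_nonneg _ _ _) (hU0 _)))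
      _ = J + (R * ρ) ^ N / L * I := by
          rw [integral_add hind (hint.const_mul _), integral_const_mul,
            integral_indicator measurableSet_closedBall]
  have hRN : 1 ≤ R ^ N := one_le_pow₀ hR
  calc (R ^ N)⁻¹ * ∫ z in B, U (x + z) ≤ (R ^ N)⁻¹ * (J + (R * ρ) ^ N / L * I) := by gcongr
    _ = (R ^ N)⁻¹ * J + ρ ^ N / L * I := by rw [mul_pow]; field_simp
    _ ≤ J + ρ ^ N / L * I := by
        have := mul_le_of_le_one_left hJ (inv_le_one_of_one_le₀ hRN)
        linarith

end KernelBounds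

/-! ### Non-negativity of λu - Δu. -/

section Positivity

variable {E : Type*} [NormedAddCommGroup E] [InnerProductSpace ℝ E] [FiniteDimensional ℝ E]
  [MeasurableSpace E] [BorelSpace E] [Nontrivial E] (μ : Measure E) [μ.IsAddHaarMeasure]

/-- If `u ≥ 0` has bounded averages over large balls and `lam u - Δ u` is superharmonic, then
`lam u - Δ u ≥ 0`. -/
theorem sub_laplacian_nonneg_of_bounded_averages {lam : ℝ} (hlam : 0 ≤ lam) {u : E → ℝ}
    (hu : ContDiff ℝ 4 u) (hu0 : ∀ x, 0 ≤ u x)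
    (hΔ : ∀ x, Δ (fun y => lam * u y - Δ u y) x ≤ 0) (x : E)
    (hgrowth : ∀ ρ : ℝ, 0 < ρ → ∃ C, ∀ R : ℝ, 1 ≤ R →
      ∫ y in Metric.closedBall (0 : E) ρ, u (x + R • y) ∂μ ≤ C) :
    0 ≤ lam * u x - Δ u x := by
  obtain ⟨Ψ, φ, hΨ, hφ, hΨs, hφs, hΨ0, hφ0, ⟨y₀, hy₀⟩, hΨφ⟩ := exists_radial_weight E
  have hu2 : ContDiff ℝ 2 u := hu.of_le (by norm_num)
  have hΔu : ContDiff ℝ 2 (Δ u) := hu.laplacian (by norm_num)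
  have hφint : 0 < ∫ y, φ y ∂μ :=
    hφ.continuous.integral_pos_of_hasCompactSupport_nonneg_nonzero hφs hφ0 hy₀
  have hΔφ : Continuous (Δ φ) := (hφ.laplacian (m := 0) (by norm_num)).continuous
  have hΔφ0 : ∀ y, y ∉ tsupport φ → Δ φ y = 0 := by
    intro y hy
    have h0 : φ =ᶠ[𝓝 y] fun _ => 0 := notMem_tsupport_iff_eventuallyEq.1 hy
    have := (InnerProductSpace.laplacian_congr_nhds h0).eq_of_nhds
    simpa using this
  have hΔφs : HasCompactSupport (Δ φ) := HasCompactSupport.intro hφs hΔφ0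
  obtain ⟨M, hM⟩ := hΔφs.exists_bound_of_continuous hΔφ
  obtain ⟨ρ, hρ, hsub⟩ := hφs.isBounded.subset_closedBall_lt 0 0
  obtain ⟨C, hC⟩ := hgrowth ρ hρ
  have hM0 : 0 ≤ M := (norm_nonneg _).trans (hM x)
  -- Moving the Laplacian from y ↦ u(x + Ry) onto φ gains R^(-2), while the averages of u stay
  -- bounded by C; the term with λu is non-negative and is dropped.
  have hbound : ∀ R : ℝ, 1 ≤ R →
      -(M * C) / R ^ 2 ≤ (lam * u x - Δ u x) * ∫ y, φ y ∂μ := by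
    intro R hR
    have hR0 : 0 < R := by linarith
    refine le_trans ?_ (integral_dilation_le_of_laplacian_nonpos μ
      ((contDiff_const.mul hu2).sub hΔu) hΔ hΨ hφ.continuous hΨs hφs hΨ0 hΨφ x hR0.le)
    have huR : ContDiff ℝ 2 fun y => u (x + R • y) :=
      hu2.comp (contDiff_const.add (contDiff_const.smul contDiff_id))
    have hΔuR : Continuous fun y => Δ u (x + R • y) := by
      have := hΔu.continuous
      fun_prop
    have hi1 : Integrable (fun y => lam * u (x + R • y) * φ y) μ :=
      ((continuous_const.mul huR.continuous).mul hφ.continuous).integrable_of_hasCompactSupport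
        hφs.mul_left
    have hi2 : Integrable (fun y => Δ u (x + R • y) * φ y) μ :=
      (hΔuR.mul hφ.continuous).integrable_of_hasCompactSupport hφs.mul_left
    have hparts : R ^ 2 * ∫ y, Δ u (x + R • y) * φ y ∂μ = ∫ y, u (x + R • y) * Δ φ y ∂μ := by
      rw [← integral_laplacian_mul_eq μ huR hφ hφs, ← integral_const_mul]
      refine integral_congr_ae (Eventually.of_forall fun y => ?_)
      simp only
      rw [laplacian_comp_add_smul hu2]
      ring
    have hle : ∫ y, u (x + R • y) * Δ φ y ∂μ ≤ M * C := by
      have hsupp : Function.support (fun y => u (x + R • y) * Δ φ y) ⊆ Metric.closedBall 0 ρ := by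
        intro y hy
        by_contra hyn
        exact hy (by simp [hΔφ0 y fun h => hyn (hsub h)])
      rw [← setIntegral_eq_integral_of_forall_compl_eq_zero (s := Metric.closedBall 0 ρ)
        fun y hy => by simpa using Function.notMem_support.1 fun h => hy (hsupp h)]
      calc ∫ y in Metric.closedBall 0 ρ, u (x + R • y) * Δ φ y ∂μ
          ≤ ∫ y in Metric.closedBall 0 ρ, M * u (x + R • y) ∂μ := by
            refine setIntegral_mono_on
              ((huR.continuous.mul hΔφ).continuousOn.integrableOn_compact (isCompact_closedBall _ _))
              ((continuous_const.mul huR.continuous).continuousOn.integrableOn_compact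
                (isCompact_closedBall _ _)) measurableSet_closedBall fun y _ => ?_
            rw [mul_comm]
            exact mul_le_mul_of_nonneg_right ((le_abs_self _).trans (hM y)) (hu0 _)
        _ = M * ∫ y in Metric.closedBall 0 ρ, u (x + R • y) ∂μ := integral_const_mul _ _
        _ ≤ M * C := mul_le_mul_of_nonneg_left (hC R hR) hM0
    have hpos : 0 ≤ ∫ y, lam * u (x + R • y) * φ y ∂μ :=
      integral_nonneg fun y => mul_nonneg (mul_nonneg hlam (hu0 _)) (hφ0 y)
    simp_rw [sub_mul]
    rw [integral_sub hi1 hi2, neg_div]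
    have : ∫ y, Δ u (x + R • y) * φ y ∂μ ≤ M * C / R ^ 2 := by
      rw [le_div_iff₀ (by positivity), mul_comm, hparts]
      exact hle
    linarith
  have hlim : Tendsto (fun R : ℝ => -(M * C) / R ^ 2) atTop (𝓝 0) :=
    tendsto_const_nhds.div_atTop (tendsto_pow_atTop (by norm_num))
  have := le_of_tendsto hlim ((eventually_ge_atTop 1).mono hbound)
  exact nonneg_of_mul_nonneg_left this hφint

end Positivity

/-! ### Comparison functions: fundamental solution and quadratic barriers. -/

section Comparison

theorem contDiff_norm_sub_sq {E : Type*} [NormedAddCommGroup E] [InnerProductSpace ℝ E]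
    {n : WithTop ℕ∞} (c : E) : ContDiff ℝ n fun y : E => ‖y - c‖ ^ 2 :=
  (contDiff_id.sub contDiff_const).norm_sq ℝ

variable {E : Type*} [NormedAddCommGroup E] [InnerProductSpace ℝ E] [FiniteDimensional ℝ E]

theorem laplacian_norm_sub_sq (c x : E) :
    Δ (fun y => ‖y - c‖ ^ 2) x = 2 * Module.finrank ℝ E := by
  have := laplacian_comp_norm_sq (g := id) (g₁ := fun _ => 1) (g₂ := 0) (c := c) (x := x)
    (Eventually.of_forall fun t => hasDerivAt_id t) (hasDerivAt_const _ _)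
  simpa using this

theorem ContDiffAt.laplacian_sub_const_mul {f g : E → ℝ} {x : E} (hf : ContDiffAt ℝ 2 f x)
    (hg : ContDiffAt ℝ 2 g x) (a d : ℝ) :
    Δ (fun y => f y - a * (g y - d)) x = Δ f x - a * Δ g x := by
  have h1 := hf.laplacian_sub ((hg.sub (contDiffAt_const (c := d))).const_smul a)
  have h2 := InnerProductSpace.laplacian_smul a (hg.sub (contDiffAt_const (c := d)))
  have h3 := hg.laplacian_sub (contDiffAt_const (c := d))
  have h4 : Δ (fun _ : E => d) x = 0 := by simp
  rw [h4, sub_zero] at h3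
  refine h1.trans ?_
  rw [← h3]
  exact congrArg (Δ f x - ·) h2

/-- A positive superharmonic function decays at most like the fundamental solution. -/
theorem mul_rpow_le_of_superharmonic (hn : 2 < Module.finrank ℝ E) {v : E → ℝ}
    (hv : ContDiff ℝ 2 v) (hΔ : ∀ x, Δ v x ≤ 0) (hv0 : ∀ x, 0 ≤ v x) {c : E} {m R T : ℝ}
    (hm : 0 < m) (hR : 0 < R) (hRT : R ≤ T) (hvm : ∀ x ∈ Metric.closedBall c R, m ≤ v x) {x : E}
    (hx : ‖x - c‖ ≤ T) :
    m * (R ^ 2 / 2 / T ^ 2) ^ (((Module.finrank ℝ E : ℝ) - 2) / 2) ≤ v x := by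
  set n := (Module.finrank ℝ E : ℝ)
  have hn' : 2 < n := by
    simp only [n]
    exact_mod_cast hn
  set s := (n - 2) / 2
  have hs : 0 < s := by simp only [s]; linarith
  have hT : 0 < T := hR.trans_le hRT
  rcases le_or_gt ‖x - c‖ R with hxR | hxR
  · refine le_trans (mul_le_of_le_one_right hm.le ?_) (hvm x (by simpa [dist_eq_norm] using hxR))
    refine Real.rpow_le_one (by positivity) ?_ hs.le
    rw [div_le_one (by positivity)]
    nlinarith
  -- The shift by -R²/2 makes the power strictly subharmonic outside the ball of radius R, as the
  -- strict minimum principle requires; the fundamental solution itself is only harmonic. A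
  -- normalises the barrier to be at most m on the inner sphere.
  set k := -(R ^ 2 / 2)
  set A := (R ^ 2 / 2) ^ s
  have hA : 0 < A := Real.rpow_pos_of_pos (by positivity) _
  let F : E → ℝ := fun y => (k + ‖y - c‖ ^ 2) ^ (-s)
  have hbase : ∀ {t : ℝ}, R ≤ t → R ^ 2 / 2 ≤ k + t ^ 2 := fun {t} ht => by
    simp only [k]; nlinarith
  have hcomp : ∀ S, ‖x - c‖ ≤ S → m * A * (F x - (k + S ^ 2) ^ (-s)) ≤ v x := by
    intro S hS
    let K : Set E := Metric.closedBall c S ∩ {y | R ≤ ‖y - c‖}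
    have hK : IsCompact K := (isCompact_closedBall c S).inter_right
      (isClosed_le continuous_const (by fun_prop))
    have hpos : ∀ y ∈ K, 0 < k + ‖y - c‖ ^ 2 := fun y hy =>
      lt_of_lt_of_le (by positivity) (hbase hy.2)
    have hFc : ∀ y ∈ K, ContDiffAt ℝ 2 F y := fun y hy => contDiffAt_rpow_add_norm_sq (hpos y hy)
    have hwc : ∀ y ∈ K, ContDiffAt ℝ 2
        (fun y => v y - m * A * (F y - (k + S ^ 2) ^ (-s))) y := fun y hy =>
      hv.contDiffAt.sub (contDiffAt_const.mul ((hFc y hy).sub contDiffAt_const))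
    have := hK.nonneg_of_laplacian_neg
      (fun y hy => (hwc y hy).continuousAt.continuousWithinAt) (fun y hy hneg => ?_) x
      ⟨by simpa [dist_eq_norm] using hS, hxR.le⟩
    · linarith
    · have hyS : ‖y - c‖ ≤ S := by simpa [dist_eq_norm] using hy.1
      have h1 : R < ‖y - c‖ := by
        refine lt_of_le_of_ne hy.2 fun hRy => hneg.not_ge ?_
        have h2 : F y = A⁻¹ := by
          simp only [F, A, ← hRy, k]
          rw [← Real.rpow_neg (by positivity)]
          congr 1
          ring
        have h3 := hvm y (by simp [dist_eq_norm, ← hRy])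
        have h4 : 0 ≤ (k + S ^ 2) ^ (-s) :=
          Real.rpow_nonneg ((hpos y hy).le.trans (by gcongr)) _
        have h5 : m * A * (F y - (k + S ^ 2) ^ (-s)) = m - m * A * (k + S ^ 2) ^ (-s) := by
          rw [h2]
          field_simp
        have h6 : 0 ≤ m * A * (k + S ^ 2) ^ (-s) := by positivity
        linarith
      have h2 : ‖y - c‖ < S := by
        refine lt_of_le_of_ne hyS fun hyS => hneg.not_ge ?_
        simp only [F, hyS, sub_self, mul_zero, sub_zero]
        exact hv0 y
      refine ⟨?_, hwc y hy, ?_⟩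
      · refine inter_mem ?_ ?_
        · exact mem_of_superset (Metric.isOpen_ball.mem_nhds (by simpa [dist_eq_norm] using h2))
            Metric.ball_subset_closedBall
        · have hc : Continuous fun y : E => ‖y - c‖ := by fun_prop
          exact (hc.continuousAt.eventually (lt_mem_nhds h1)).mono fun z hz => le_of_lt hz
      · rw [hv.contDiffAt.laplacian_sub_const_mul (hFc y hy), laplacian_rpow_add_norm_sq (hpos y hy)]
        have h3 : 0 < (k + ‖y - c‖ ^ 2) ^ (-(s + 2)) := Real.rpow_pos_of_pos (hpos y hy) _
        have h4 : (Module.finrank ℝ E : ℝ) - 2 - 2 * s = 0 := by simp only [s, n]; ring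
        rw [h4]
        have h5 : 0 < -k := by simp only [k]; nlinarith
        have h6 : 0 < m * A * (4 * s * (s + 1) * (-k) * (k + ‖y - c‖ ^ 2) ^ (-(s + 2))) := by
          positivity
        have h7 := hΔ y
        linarith
  -- The subtracted constant makes the barrier vanish at radius S, where only v ≥ 0 is known; it
  -- disappears as S → ∞.
  have hlim : Tendsto (fun S : ℝ => m * A * (F x - (k + S ^ 2) ^ (-s))) atTop
      (𝓝 (m * A * (F x - 0))) := by
    refine Tendsto.const_mul _ (Tendsto.const_sub _ ?_)
    refine (tendsto_rpow_neg_atTop hs).comp ?_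
    exact tendsto_atTop_add_const_left _ _ (tendsto_pow_atTop (by norm_num))
  have hlow : m * A * (F x - 0) ≤ v x :=
    le_of_tendsto hlim ((eventually_ge_atTop ‖x - c‖).mono hcomp)
  refine le_trans ?_ hlow
  rw [sub_zero, mul_assoc]
  refine mul_le_mul_of_nonneg_left ?_ hm.le
  rw [Real.div_rpow (by positivity) (by positivity), div_eq_mul_inv, ← Real.rpow_neg (by positivity)]
  refine mul_le_mul_of_nonneg_left ?_ hA.le
  have h1 : 0 < k + ‖x - c‖ ^ 2 := lt_of_lt_of_le (by positivity) (hbase hxR.le)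
  refine Real.rpow_le_rpow_of_nonpos h1 ?_ (by linarith)
  simp only [k]
  nlinarith [norm_nonneg (x - c)]

/-- Asking for the Laplacian sign only where w < 0 lets a zero order term be controlled, since there
the unknown lies below the barrier. -/
theorem nonneg_of_laplacian_neg_closedBall {w : E → ℝ} {c : E} {R : ℝ}
    (hw : ContDiff ℝ 2 w) (hbd : ∀ x, ‖x - c‖ = R → 0 ≤ w x)
    (h : ∀ x, ‖x - c‖ < R → w x < 0 → Δ w x < 0) {x : E} (hx : ‖x - c‖ ≤ R) : 0 ≤ w x := by
  refine (isCompact_closedBall c R).nonneg_of_laplacian_neg hw.continuous.continuousOn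
    (fun y hy hneg => ?_) x (by simpa [dist_eq_norm] using hx)
  have hy' : ‖y - c‖ ≤ R := by simpa [dist_eq_norm] using hy
  have hlt : ‖y - c‖ < R := lt_of_le_of_ne hy' fun he => hneg.not_ge (hbd y he)
  exact ⟨mem_of_superset (Metric.isOpen_ball.mem_nhds (by simpa [dist_eq_norm] using hlt))
    Metric.ball_subset_closedBall, hw.contDiffAt, h y hlt hneg⟩

/-- Lower bound in a ball for non-negative functions with `Δ v ≤ -F`. -/
theorem mul_sq_sub_le_of_laplacian_le_neg (hn : 0 < Module.finrank ℝ E) {v : E → ℝ}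
    (hv : ContDiff ℝ 2 v) (hv0 : ∀ x, 0 ≤ v x) {c : E} {F R : ℝ} (hF : 0 < F)
    (hΔ : ∀ x, ‖x - c‖ ≤ R → Δ v x ≤ -F) {x : E} (hx : ‖x - c‖ ≤ R) :
    F / (4 * Module.finrank ℝ E) * (R ^ 2 - ‖x - c‖ ^ 2) ≤ v x := by
  have hn' : (0 : ℝ) < Module.finrank ℝ E := by exact_mod_cast hn
  set a := F / (4 * Module.finrank ℝ E)
  have := nonneg_of_laplacian_neg_closedBall (c := c) (R := R)
    (w := fun y => v y - (-a) * (‖y - c‖ ^ 2 - R ^ 2))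
    (hv.sub (contDiff_const.mul ((contDiff_norm_sub_sq c).sub contDiff_const)))
    (fun y hy => by simpa [hy] using hv0 y) (fun y hy _ => ?_) hx
  · linarith
  · rw [hv.contDiffAt.laplacian_sub_const_mul (contDiff_norm_sub_sq c).contDiffAt,
      laplacian_norm_sub_sq]
    have h1 := hΔ y hy.le
    have h2 : a * (2 * Module.finrank ℝ E) = F / 2 := by
      simp only [a]
      field_simp
      norm_num
    linarith

/-- Lower bound in a ball for non-negative functions with `lam u - Δ u ≥ m`. -/
theorem mul_one_sub_le_of_le_sub_laplacian {u : E → ℝ}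
    (hu : ContDiff ℝ 2 u) (hu0 : ∀ x, 0 ≤ u x) {c : E} {lam m R : ℝ} (hlam : 0 < lam) (hm : 0 < m)
    (hR : 1 ≤ R) (hle : ∀ x, ‖x - c‖ ≤ R → m ≤ lam * u x - Δ u x) {x : E} (hx : ‖x - c‖ ≤ R) :
    m / (lam + 2 * Module.finrank ℝ E) * (1 - ‖x - c‖ ^ 2 / R ^ 2) ≤ u x := by
  set n := (Module.finrank ℝ E : ℝ)
  have hn : 0 ≤ n := Nat.cast_nonneg _
  -- Where w < 0 one has u < ε, so Δw ≤ λu - m + 2na < λε + 2nε - m = 0. R ≥ 1 is what gives a ≤ ε,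
  -- with a constant independent of R.
  set ε := m / (lam + 2 * n)
  have hε : 0 < ε := by positivity
  have hR2 : 1 ≤ R ^ 2 := one_le_pow₀ hR
  set a := ε / R ^ 2
  have ha : 0 < a := by positivity
  have haR : a * R ^ 2 = ε := by simp only [a]; field_simp
  have haε : a ≤ ε := div_le_self hε.le hR2
  have := nonneg_of_laplacian_neg_closedBall (c := c) (R := R)
    (w := fun y => u y - (-a) * (‖y - c‖ ^ 2 - R ^ 2))
    (hu.sub (contDiff_const.mul ((contDiff_norm_sub_sq c).sub contDiff_const)))
    (fun y hy => by simpa [hy] using hu0 y) (fun y hy hneg => ?_) hx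
  · have h1 : ε * (1 - ‖x - c‖ ^ 2 / R ^ 2) = a * (R ^ 2 - ‖x - c‖ ^ 2) := by
      simp only [a]
      field_simp
    rw [h1]
    linarith
  · rw [hu.contDiffAt.laplacian_sub_const_mul (contDiff_norm_sub_sq c).contDiffAt,
      laplacian_norm_sub_sq]
    have h1 := hle y hy.le
    have h2 : u y < ε := by nlinarith [sq_nonneg ‖y - c‖]
    have h3 : lam * ε + 2 * n * ε = m := by simp only [ε]; field_simp
    have h4 : lam * u y < lam * ε := by gcongr
    have h5 : 2 * n * a ≤ 2 * n * ε := by gcongr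
    change Δ u y - -a * (2 * n) < 0
    linarith

end Comparison

/-! ### Necessity of the exponent condition. -/

section Necessity

variable {N : ℕ}

/-- Lower bound of the convolution with the logarithmic kernel at the scale `R`. -/
theorem le_integral_logRieszKernel_mul (hN : 3 ≤ N) {p β a R : ℝ} (hp : 0 ≤ p) (hβ : 0 ≤ β)
    {u : EuclideanSpace ℝ (Fin N) → ℝ} (hu0 : ∀ x, 0 ≤ u x) {c x : EuclideanSpace ℝ (Fin N)}
    (ha : 0 ≤ a) (hR : 0 < R) (hau : ∀ y, ‖y - c‖ ≤ 5 * R → a ≤ u y) (hx : ‖x - c‖ ≤ 2 * R)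
    (hint : Integrable fun t => logRieszKernel N N β t * u (x - t) ^ p) :
    a ^ p * ((7 : ℝ) ^ N)⁻¹ * Real.log (1 + R) ^ β *
      (volume (Metric.ball (0 : EuclideanSpace ℝ (Fin N)) 1)).toReal ≤
      ∫ t, logRieszKernel N N β t * u (x - t) ^ p := by
  have : Nonempty (Fin N) := ⟨⟨0, by omega⟩⟩
  -- With |x-c| ≤ 2R, the offset 4R places the ball B of radius R in the annulus R ≤ |t| ≤ 7R, while
  -- x - t stays within 5R of c.
  obtain ⟨e, he⟩ := exists_norm_eq (EuclideanSpace ℝ (Fin N)) (show 0 ≤ 4 * R by positivity)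
  set B := Metric.ball (x - c - e) R
  have hB : MeasurableSet B := measurableSet_ball
  set k := (7 * R) ^ (-(N : ℝ)) * Real.log (1 + R) ^ β
  have hvol : (volume B).toReal =
      R ^ N * (volume (Metric.ball (0 : EuclideanSpace ℝ (Fin N)) 1)).toReal := by
    rw [Measure.addHaar_ball _ _ hR.le, ENNReal.toReal_mul, finrank_euclideanSpace_fin,
      ENNReal.toReal_ofReal (by positivity)]
  have hpt : ∀ t ∈ B, k * a ^ p ≤ logRieszKernel N N β t * u (x - t) ^ p := by
    intro t ht
    have ht' : ‖t - (x - c - e)‖ < R := by simpa [B, dist_eq_norm] using ht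
    have h1 : R ≤ ‖t‖ := by
      have e1 : e = (x - c) + (t - (x - c - e)) - t := by abel
      have e2 : ‖e‖ ≤ ‖x - c‖ + ‖t - (x - c - e)‖ + ‖t‖ := by
        conv_lhs => rw [e1]
        exact (norm_sub_le _ _).trans (by gcongr; exact norm_add_le _ _)
      linarith
    have h2 : ‖t‖ ≤ 7 * R := by
      have e1 : t = (x - c) + (t - (x - c - e)) - e := by abel
      have e2 : ‖t‖ ≤ ‖x - c‖ + ‖t - (x - c - e)‖ + ‖e‖ := by
        conv_lhs => rw [e1]
        exact (norm_sub_le _ _).trans (by gcongr; exact norm_add_le _ _)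
      linarith
    have h3 : ‖x - t - c‖ ≤ 5 * R := by
      have e1 : x - t - c = e - (t - (x - c - e)) := by abel
      rw [e1]
      linarith [norm_sub_le e (t - (x - c - e))]
    exact mul_le_mul (le_logRieszKernel (Nat.cast_nonneg N) hβ hR h1 h2)
      (Real.rpow_le_rpow ha (hau _ h3) hp) (Real.rpow_nonneg ha _) (logRieszKernel_nonneg _ _ _)
  calc a ^ p * ((7 : ℝ) ^ N)⁻¹ * Real.log (1 + R) ^ β *
      (volume (Metric.ball (0 : EuclideanSpace ℝ (Fin N)) 1)).toReal
      = (volume B).toReal * (k * a ^ p) := by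
        rw [hvol]
        simp only [k]
        rw [Real.rpow_neg (by positivity), Real.rpow_natCast, mul_pow]
        field_simp
    _ = ∫ t in B, k * a ^ p := by
        rw [setIntegral_const]
        rfl
    _ ≤ ∫ t in B, logRieszKernel N N β t * u (x - t) ^ p :=
        setIntegral_mono_on (integrableOn_const measure_ball_lt_top.ne) hint.integrableOn hB hpt
    _ ≤ _ := setIntegral_le_integral hint (Eventually.of_forall fun t =>
        mul_nonneg (logRieszKernel_nonneg _ _ _) (Real.rpow_nonneg (hu0 _) _))

namespace IsNonnegSolution

variable {p q β lam : ℝ} {u : EuclideanSpace ℝ (Fin N) → ℝ}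

theorem integrable (h : IsNonnegSolution N N β lam p q u) (x : EuclideanSpace ℝ (Fin N)) :
    Integrable fun t => logRieszKernel N N β t * u (x - t) ^ p :=
  h.convolutionExists x

theorem laplacian_sub_laplacian (h : IsNonnegSolution N N β lam p q u)
    (x : EuclideanSpace ℝ (Fin N)) :
    Δ (fun y => lam * u y - Δ u y) x = lam * Δ u x - Δ (Δ u) x := by
  have hu2 : ContDiff ℝ 2 u := h.contDiff.of_le (by norm_num)
  have hΔu : ContDiff ℝ 2 (Δ u) := h.contDiff.laplacian (by norm_num)
  have h1 := (hu2.contDiffAt (x := x)).const_smul lam |>.laplacian_sub hΔu.contDiffAt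
  have h2 := InnerProductSpace.laplacian_smul lam (hu2.contDiffAt (x := x))
  refine h1.trans ?_
  exact congrArg (· - Δ (Δ u) x) h2

theorem laplacian_sub_laplacian_le (h : IsNonnegSolution N N β lam p q u)
    (x : EuclideanSpace ℝ (Fin N)) :
    Δ (fun y => lam * u y - Δ u y) x ≤
      -((∫ t, logRieszKernel N N β t * u (x - t) ^ p) * u x ^ q) := by
  have h1 := h.inequality x
  have h2 := h.laplacian_sub_laplacian x
  have h3 : (∫ t, logRieszKernel N N β t * u (x - t) ^ p) * u x ^ q ≤
    Δ (Δ u) x - lam * Δ u x := h1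
  linarith

theorem contDiff_sub_laplacian (h : IsNonnegSolution N N β lam p q u) :
    ContDiff ℝ 2 (fun y => lam * u y - Δ u y) :=
  (contDiff_const.mul (h.contDiff.of_le (by norm_num))).sub (h.contDiff.laplacian (by norm_num))

theorem integral_mul_nonneg (h : IsNonnegSolution N N β lam p q u)
    (x : EuclideanSpace ℝ (Fin N)) :
    0 ≤ (∫ t, logRieszKernel N N β t * u (x - t) ^ p) * u x ^ q :=
  mul_nonneg (integral_nonneg fun _ =>
    mul_nonneg (logRieszKernel_nonneg _ _ _) (Real.rpow_nonneg (h.nonneg _) _))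
    (Real.rpow_nonneg (h.nonneg _) _)

/-- Convergence of the convolution bounds the averages of u^p; since p ≥ 1, t ≤ 1 + t^p transfers
the bound to u. -/
theorem sub_laplacian_nonneg (h : IsNonnegSolution N N β lam p q u) (hN : 3 ≤ N) (hp : 1 ≤ p)
    (hβ : 0 < β) (hlam : 0 < lam) (x : EuclideanSpace ℝ (Fin N)) : 0 ≤ lam * u x - Δ u x := by
  have : Nonempty (Fin N) := ⟨⟨0, by omega⟩⟩
  have hΔ : ∀ x, Δ (fun y => lam * u y - Δ u y) x ≤ 0 := fun x =>
    (h.laplacian_sub_laplacian_le x).trans (neg_nonpos.2 (h.integral_mul_nonneg x))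
  have hu := h.contDiff.continuous
  have hup : Continuous fun y => u y ^ p := hu.rpow_const fun y => Or.inr (by linarith)
  refine sub_laplacian_nonneg_of_bounded_averages volume hlam.le h.contDiff h.nonneg hΔ x
    fun ρ hρ => ?_
  have hint : Integrable fun z => logRieszKernel N N β z * u (x + z) ^ p := by
    have := (h.integrable x).comp_neg
    simpa [logRieszKernel_neg] using this
  obtain ⟨C, hC⟩ := exists_setIntegral_dilation_le hβ.le hup
    (fun y => Real.rpow_nonneg (h.nonneg y) p) hint hρ
  have hfin : volume (Metric.closedBall (0 : EuclideanSpace ℝ (Fin N)) ρ) ≠ ⊤ :=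
    measure_closedBall_lt_top.ne
  refine ⟨(∫ y in Metric.closedBall (0 : EuclideanSpace ℝ (Fin N)) ρ, (1 : ℝ)) + C,
    fun R hR => ?_⟩
  have hi : IntegrableOn (fun y => u (x + R • y) ^ p)
      (Metric.closedBall (0 : EuclideanSpace ℝ (Fin N)) ρ) :=
    (hup.comp (by fun_prop : Continuous fun y => x + R • y)).continuousOn.integrableOn_compact
      (isCompact_closedBall _ _)
  have hi' : IntegrableOn (fun y => u (x + R • y))
      (Metric.closedBall (0 : EuclideanSpace ℝ (Fin N)) ρ) :=
    (hu.comp (by fun_prop : Continuous fun y => x + R • y)).continuousOn.integrableOn_compact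
      (isCompact_closedBall _ _)
  have hone : IntegrableOn (fun _ => (1 : ℝ))
      (Metric.closedBall (0 : EuclideanSpace ℝ (Fin N)) ρ) := integrableOn_const hfin
  calc ∫ y in Metric.closedBall (0 : EuclideanSpace ℝ (Fin N)) ρ, u (x + R • y)
      ≤ ∫ y in Metric.closedBall (0 : EuclideanSpace ℝ (Fin N)) ρ, (1 + u (x + R • y) ^ p) := by
        refine setIntegral_mono_on hi' (hone.add hi) measurableSet_closedBall fun y _ => ?_
        rcases le_total (u (x + R • y)) 1 with h1 | h1
        · linarith [Real.rpow_nonneg (h.nonneg (x + R • y)) p]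
        · linarith [Real.self_le_rpow_of_one_le h1 hp]
    _ = _ := integral_add hone hi
    _ ≤ _ := by gcongr; exact hC R hR

/-- `lam u - Δ u` is bounded below by a positive constant on some ball. -/
theorem exists_pos_le_sub_laplacian (h : IsNonnegSolution N N β lam p q u) (hN : 3 ≤ N)
    (hp : 1 ≤ p) (hβ : 0 < β) (hlam : 0 < lam) :
    ∃ c : EuclideanSpace ℝ (Fin N), ∃ r m : ℝ, 0 < r ∧ 0 < m ∧
      ∀ x ∈ Metric.closedBall c r, m ≤ lam * u x - Δ u x := by
  have : Nonempty (Fin N) := ⟨⟨0, by omega⟩⟩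
  obtain ⟨c, hc⟩ := h.nontrivial
  have hc0 : 0 < u c := lt_of_le_of_ne (h.nonneg c) hc.symm
  obtain ⟨δ, hδ, hball⟩ := Metric.nhds_basis_closedBall.eventually_iff.1
    (h.contDiff.continuous.continuousAt.eventually (lt_mem_nhds (half_lt_self hc0)))
  set R := δ / 5
  have hR : 0 < R := by positivity
  have hau : ∀ y, ‖y - c‖ ≤ 5 * R → u c / 2 ≤ u y := fun y hy =>
    (hball (by simp only [Metric.mem_closedBall, dist_eq_norm]; simp only [R] at hy; linarith)).le
  have hv := h.contDiff_sub_laplacian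
  obtain ⟨z, hz, hmin⟩ := (isCompact_closedBall c R).exists_isMinOn
    ⟨c, Metric.mem_closedBall_self hR.le⟩ hv.continuous.continuousOn
  refine ⟨c, R, lam * u z - Δ u z, hR, ?_, fun x hx => hmin hx⟩
  have hz' : ‖z - c‖ ≤ R := by simpa [dist_eq_norm] using hz
  -- A zero of v would be a global minimum, hence Δv ≥ 0 there, whereas u > 0 nearby makes Δv
  -- strictly negative.
  refine lt_of_le_of_ne (h.sub_laplacian_nonneg hN hp hβ hlam z) fun h0 => ?_
  have hloc : IsLocalMin (fun y => lam * u y - Δ u y) z :=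
    Eventually.of_forall fun y => by
      simp only
      rw [← h0]
      exact h.sub_laplacian_nonneg hN hp hβ hlam y
  have h1 := hloc.laplacian_nonneg hv.contDiffAt
  have h2 := h.laplacian_sub_laplacian_le z
  have h3 := le_integral_logRieszKernel_mul hN (by linarith : 0 ≤ p) hβ.le h.nonneg
    (by positivity) hR hau (by linarith : ‖z - c‖ ≤ 2 * R) (h.integrable z)
  have h4 : 0 < u z := lt_of_lt_of_le (by positivity) (hau z (by linarith))
  have h5 : 0 < (volume (Metric.ball (0 : EuclideanSpace ℝ (Fin N)) 1)).toReal :=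
    ENNReal.toReal_pos (Metric.measure_ball_pos _ _ one_pos).ne' measure_ball_lt_top.ne
  have h6 : 0 < Real.log (1 + R) := Real.log_pos (by linarith)
  have h7 : 0 < (∫ t, logRieszKernel N N β t * u (z - t) ^ p) * u z ^ q :=
    mul_pos (lt_of_lt_of_le (by positivity) h3) (Real.rpow_pos_of_pos h4 _)
  linarith

/-- The exponent condition is necessary. -/
theorem div_lt_add (h : IsNonnegSolution N N β lam p q u) (hN : 3 ≤ N)
    (hp : 1 ≤ p) (hq : 0 < q) (hβ : 0 < β) (hlam : 0 < lam) :
    (N : ℝ) / ((N : ℝ) - 2) < p + q := by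
  have : Nonempty (Fin N) := ⟨⟨0, by omega⟩⟩
  by_contra! hcrit
  have hN3 : (3 : ℝ) ≤ N := by exact_mod_cast hN
  have hN2 : (0 : ℝ) < N - 2 := by linarith
  rw [le_div_iff₀ hN2] at hcrit
  obtain ⟨c, r, m₀, hr, hm₀, hvm₀⟩ := h.exists_pos_le_sub_laplacian hN hp hβ hlam
  set v := fun y => lam * u y - Δ u y
  have hv : ContDiff ℝ 2 v := h.contDiff_sub_laplacian
  have hv0 : ∀ x, 0 ≤ v x := h.sub_laplacian_nonneg hN hp hβ hlam
  have hΔ0 : ∀ x, Δ v x ≤ 0 := fun x =>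
    (h.laplacian_sub_laplacian_le x).trans (neg_nonpos.2 (h.integral_mul_nonneg x))
  have hrank : 2 < Module.finrank ℝ (EuclideanSpace ℝ (Fin N)) := by
    rw [finrank_euclideanSpace_fin]; omega
  set ω := (volume (Metric.ball (0 : EuclideanSpace ℝ (Fin N)) 1)).toReal
  have hω : 0 < ω :=
    ENNReal.toReal_pos (Metric.measure_ball_pos _ _ one_pos).ne' measure_ball_lt_top.ne
  set s : ℝ := ((N : ℝ) - 2) / 2
  have hs : 0 < s := by positivity
  have hspread : ∀ {m R T : ℝ} {x : EuclideanSpace ℝ (Fin N)}, 0 < m → 0 < R → R ≤ T →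
      (∀ x ∈ Metric.closedBall c R, m ≤ v x) → ‖x - c‖ ≤ T →
      m * (R ^ 2 / 2 / T ^ 2) ^ s ≤ v x := by
    intro m R T x hm hR hRT hvm hx
    have := mul_rpow_le_of_superharmonic hrank hv hΔ0 hv0 hm hR hRT hvm hx
    rwa [finrank_euclideanSpace_fin] at this
  -- 1/128 is (R²/2)/(8R)². The extra 1/2 in κ' bounds 1 - (5/8)² from below, and 3/(4N) in C₁ comes
  -- from the quadratic barrier on radius 2R evaluated within radius R.
  set κ : ℝ := (1 / 128) ^ s
  have hκ : 0 < κ := Real.rpow_pos_of_pos (by norm_num) _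
  set κ' : ℝ := κ / (lam + 2 * N) / 2
  have hκ' : 0 < κ' := by positivity
  set C₁ : ℝ := κ' ^ p * κ' ^ q * ((7 : ℝ) ^ N)⁻¹ * ω * 3 / (4 * N)
  have hC₁ : 0 < C₁ := by positivity
  set C₂ : ℝ := m₀ * (r ^ 2 / 2) ^ s
  have hC₂ : 0 < C₂ := by positivity
  have hbound : ∀ R : ℝ, 1 ≤ R → r ≤ R →
      Real.log (1 + R) ^ β ≤ (C₁ * C₂ ^ (p + q - 1))⁻¹ := by
    intro R hR1 hrR
    have hR : 0 < R := by linarith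
    obtain ⟨z, hz, hmin⟩ := (isCompact_closedBall c R).exists_isMinOn
      ⟨c, Metric.mem_closedBall_self hR.le⟩ hv.continuous.continuousOn
    have hz' : ‖z - c‖ ≤ R := by simpa [dist_eq_norm] using hz
    have hlow := hspread hm₀ hr hrR hvm₀ hz'
    set m := v z
    have hm : 0 < m := lt_of_lt_of_le (by positivity) hlow
    have hmR : C₂ * R ^ (-((N : ℝ) - 2)) ≤ m := by
      refine le_of_eq_of_le ?_ hlow
      rw [Real.div_rpow (by positivity) (by positivity), ← Real.rpow_natCast_mul hR.le,
        Real.rpow_neg hR.le]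
      simp only [C₂, s]
      rw [show ((2 : ℕ) : ℝ) * (((N : ℝ) - 2) / 2) = (N : ℝ) - 2 by push_cast; ring]
      field_simp
    have hv8 : ∀ x, ‖x - c‖ ≤ 8 * R → κ * m ≤ v x := by
      intro x hx
      have := hspread hm hR (by linarith) (fun y hy => hmin hy) hx
      rw [show R ^ 2 / 2 / (8 * R) ^ 2 = 1 / 128 by field_simp; norm_num] at this
      linarith
    have hu5 : ∀ x, ‖x - c‖ ≤ 5 * R → κ' * m ≤ u x := by
      intro x hx
      refine le_trans ?_ (mul_one_sub_le_of_le_sub_laplacian (h.contDiff.of_le (by norm_num))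
        h.nonneg hlam (mul_pos hκ hm) (by linarith : 1 ≤ 8 * R) hv8
        (by linarith : ‖x - c‖ ≤ 8 * R))
      rw [finrank_euclideanSpace_fin]
      have h1 : ‖x - c‖ ^ 2 / (8 * R) ^ 2 ≤ 1 / 2 := by
        rw [div_le_iff₀ (by positivity)]
        nlinarith [norm_nonneg (x - c)]
      have h2 : κ' * m = κ * m / (lam + 2 * N) * (1 / 2) := by
        simp only [κ']; ring
      rw [h2]
      have h3 : 0 < κ * m / (lam + 2 * N) := by positivity
      exact mul_le_mul_of_nonneg_left (by linarith) h3.le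
    set L := Real.log (1 + R) ^ β
    have hL : 0 < L := Real.rpow_pos_of_pos (Real.log_pos (by linarith)) _
    set F := (κ' * m) ^ p * ((7 : ℝ) ^ N)⁻¹ * L * ω * (κ' * m) ^ q
    have hF : 0 < F := by positivity
    have hΔF : ∀ x, ‖x - c‖ ≤ 2 * R → Δ v x ≤ -F := by
      intro x hx
      refine (h.laplacian_sub_laplacian_le x).trans (neg_le_neg ?_)
      exact mul_le_mul (le_integral_logRieszKernel_mul hN (by linarith) hβ.le h.nonneg
        (by positivity) hR hu5 hx (h.integrable x))
        (Real.rpow_le_rpow (by positivity) (hu5 x (by linarith)) hq.le) (by positivity)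
        (integral_nonneg fun _ =>
          mul_nonneg (logRieszKernel_nonneg _ _ _) (Real.rpow_nonneg (h.nonneg _) _))
    have hmF := mul_sq_sub_le_of_laplacian_le_neg (by omega) hv hv0 hF hΔF
      (by linarith : ‖z - c‖ ≤ 2 * R)
    rw [finrank_euclideanSpace_fin] at hmF
    have h1 : C₁ * m ^ (p + q) * L * R ^ 2 ≤ m := by
      refine le_trans ?_ hmF
      have e1 : C₁ * m ^ (p + q) * L * R ^ 2 = F / (4 * N) * (3 * R ^ 2) := by
        simp only [C₁, F]
        rw [Real.mul_rpow hκ'.le hm.le, Real.mul_rpow hκ'.le hm.le, Real.rpow_add hm]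
        ring
      rw [e1]
      refine mul_le_mul_of_nonneg_left ?_ (by positivity)
      nlinarith [norm_nonneg (z - c)]
    have h2 : C₁ * m ^ (p + q - 1) * L * R ^ 2 ≤ 1 := by
      have e1 : m ^ (p + q) = m ^ (p + q - 1) * m := by
        rw [← Real.rpow_add_one hm.ne']; congr 1; ring
      rw [e1] at h1
      by_contra! hlt
      nlinarith
    have h3 : C₂ ^ (p + q - 1) ≤ m ^ (p + q - 1) * R ^ 2 := by
      have e1 : (C₂ * R ^ (-((N : ℝ) - 2))) ^ (p + q - 1) ≤ m ^ (p + q - 1) :=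
        Real.rpow_le_rpow (by positivity) hmR (by linarith)
      rw [Real.mul_rpow hC₂.le (by positivity), ← Real.rpow_mul hR.le] at e1
      -- The total exponent 2 - (N-2)(p+q-1) is non-negative exactly when (p+q)(N-2) ≤ N.
      have e2 : (1 : ℝ) ≤ R ^ (-((N : ℝ) - 2) * (p + q - 1)) * R ^ 2 := by
        rw [← Real.rpow_natCast R 2, ← Real.rpow_add hR]
        refine Real.one_le_rpow hR1 ?_
        push_cast
        nlinarith
      calc C₂ ^ (p + q - 1) ≤ C₂ ^ (p + q - 1) *
            (R ^ (-((N : ℝ) - 2) * (p + q - 1)) * R ^ 2) :=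
            le_mul_of_one_le_right (by positivity) e2
        _ = C₂ ^ (p + q - 1) * R ^ (-((N : ℝ) - 2) * (p + q - 1)) * R ^ 2 := by ring
        _ ≤ _ := by gcongr
    rw [← one_div, le_div_iff₀ (by positivity)]
    calc L * (C₁ * C₂ ^ (p + q - 1)) ≤ L * (C₁ * (m ^ (p + q - 1) * R ^ 2)) := by gcongr
      _ = C₁ * m ^ (p + q - 1) * L * R ^ 2 := by ring
      _ ≤ 1 := h2
  have hlim : Tendsto (fun R : ℝ => Real.log (1 + R) ^ β) atTop atTop :=
    (tendsto_rpow_atTop hβ).comp (Real.tendsto_log_atTop.comp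
      (tendsto_atTop_add_const_left _ _ tendsto_id))
  obtain ⟨R, hR⟩ := ((hlim.eventually_gt_atTop (C₁ * C₂ ^ (p + q - 1))⁻¹).and
    ((eventually_ge_atTop 1).and (eventually_ge_atTop r))).exists
  exact hR.1.not_ge (hbound R hR.2.1 hR.2.2)

end IsNonnegSolution

end Necessity

/-! ### Sufficiency: an explicit solution. -/

section Sufficiency

section Barrier

variable {E : Type*} [NormedAddCommGroup E] [InnerProductSpace ℝ E]

theorem contDiff_rpow_one_add_norm_sq {n : WithTop ℕ∞} (s : ℝ) :
    ContDiff ℝ n fun y : E => ((1 + ‖y‖ ^ 2) ^ s : ℝ) := by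
  refine contDiff_iff_contDiffAt.2 fun x => ?_
  simpa using contDiffAt_rpow_add_norm_sq (k := 1) (s := s) (c := 0) (x := x) (n := n)
    (by positivity)

/-- An identity of functions, so that the Laplacian can be applied a second time. -/
theorem laplacian_rpow_one_add_norm_sq [FiniteDimensional ℝ E] (s : ℝ) :
    Δ (fun y : E => ((1 + ‖y‖ ^ 2) ^ (-s) : ℝ)) =
      (-(2 * s * ((Module.finrank ℝ E : ℝ) - 2 - 2 * s))) •
          (fun y : E => ((1 + ‖y‖ ^ 2) ^ (-(s + 1)) : ℝ)) +
        (-(4 * s * (s + 1))) • (fun y : E => ((1 + ‖y‖ ^ 2) ^ (-(s + 2)) : ℝ)) := by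
  ext x
  have := laplacian_rpow_add_norm_sq (k := 1) (s := s) (c := 0) (x := x) (by positivity)
  simp only [sub_zero] at this
  rw [this]
  simp
  ring

theorem laplacian_smul_add_smul [FiniteDimensional ℝ E] {f g : E → ℝ} (hf : ContDiff ℝ 2 f)
    (hg : ContDiff ℝ 2 g) (a b : ℝ) (x : E) : Δ (a • f + b • g) x = a * Δ f x + b * Δ g x := by
  have h1 : ContDiffAt ℝ 2 (a • f) x := (hf.const_smul a).contDiffAt
  have h2 : ContDiffAt ℝ 2 (b • g) x := (hg.const_smul b).contDiffAt
  rw [h1.laplacian_add h2,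
    InnerProductSpace.laplacian_smul a hf.contDiffAt,
    InnerProductSpace.laplacian_smul b hg.contDiffAt]
  rfl

theorem exists_le_bilaplacian_sub_laplacian [FiniteDimensional ℝ E] {s : ℝ} (hs : 0 < s)
    (hsn : 2 * s < (Module.finrank ℝ E : ℝ) - 2) :
    ∃ lam : ℝ, 0 < lam ∧ ∀ x : E, (1 + ‖x‖ ^ 2) ^ (-(s + 1)) ≤
      Δ (Δ fun y : E => ((1 + ‖y‖ ^ 2) ^ (-s) : ℝ)) x -
        lam * Δ (fun y : E => ((1 + ‖y‖ ^ 2) ^ (-s) : ℝ)) x := by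
  set n := (Module.finrank ℝ E : ℝ)
  let A : ℝ → ℝ := fun t => 2 * t * (n - 2 - 2 * t)
  let B : ℝ → ℝ := fun t => 4 * t * (t + 1)
  have hA : 0 < A s := mul_pos (by positivity) (by linarith)
  have hB : 0 < B s := by simp only [B]; positivity
  -- Every term of the bilaplacian decays at least as fast as the power -(s+1), so C bounds its
  -- negative part; λ = (1 + C)/A(s) compensates it and leaves coefficient 1.
  set C := |A s * A (s + 1)| + |A s * B (s + 1)| + |B s * A (s + 2)| + |B s * B (s + 2)|
  have hC : 0 ≤ C := by positivity
  refine ⟨(1 + C) / A s, by positivity, fun x => ?_⟩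
  let F : ℝ → ℝ := fun t => (1 + ‖x‖ ^ 2) ^ (-t)
  have hF0 : ∀ t, 0 < F t := fun t => Real.rpow_pos_of_pos (by positivity) _
  have hFle : ∀ t, s + 1 ≤ t → F t ≤ F (s + 1) := fun t ht =>
    Real.rpow_le_rpow_of_exponent_le (by nlinarith [sq_nonneg ‖x‖]) (by linarith)
  have h1 : ∀ t, Δ (fun y : E => ((1 + ‖y‖ ^ 2) ^ (-t) : ℝ)) x =
      -A t * F (t + 1) - B t * F (t + 2) := by
    intro t
    rw [laplacian_rpow_one_add_norm_sq]
    simp [A, B, F, n]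
    ring
  have h2 : Δ (Δ fun y : E => ((1 + ‖y‖ ^ 2) ^ (-s) : ℝ)) x =
      A s * A (s + 1) * F (s + 2) + A s * B (s + 1) * F (s + 3) + B s * A (s + 2) * F (s + 3) +
        B s * B (s + 2) * F (s + 4) := by
    rw [laplacian_rpow_one_add_norm_sq, laplacian_smul_add_smul (contDiff_rpow_one_add_norm_sq _)
      (contDiff_rpow_one_add_norm_sq _), h1, h1,
      show s + 1 + 1 = s + 2 by ring, show s + 1 + 2 = s + 3 by ring,
      show s + 2 + 1 = s + 3 by ring, show s + 2 + 2 = s + 4 by ring]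
    simp only [A, B]
    ring
  have h3 : ∀ c t, s + 1 ≤ t → -(|c| * F (s + 1)) ≤ c * F t := by
    intro c t ht
    have e1 : |c| * F t ≤ |c| * F (s + 1) := mul_le_mul_of_nonneg_left (hFle t ht) (abs_nonneg c)
    have e2 : -|c| * F t ≤ c * F t := mul_le_mul_of_nonneg_right (neg_abs_le c) (hF0 t).le
    linarith
  have h4 : -(C * F (s + 1)) ≤ Δ (Δ fun y : E => ((1 + ‖y‖ ^ 2) ^ (-s) : ℝ)) x := by
    rw [h2]
    have e1 := h3 (A s * A (s + 1)) (s + 2) (by linarith)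
    have e2 := h3 (A s * B (s + 1)) (s + 3) (by linarith)
    have e3 := h3 (B s * A (s + 2)) (s + 3) (by linarith)
    have e4 := h3 (B s * B (s + 2)) (s + 4) (by linarith)
    simp only [C]
    linarith
  have h5 : (1 + C) / A s * (B s * F (s + 2)) ≥ 0 := by
    have := hF0 (s + 2)
    positivity
  have h6 : (1 + C) / A s * (A s * F (s + 1)) = (1 + C) * F (s + 1) := by field_simp
  rw [h1 s]
  change F (s + 1) ≤ _
  linarith

end Barrier

/-! ### Decay of the convolution with the logarithmic kernel. -/

section Potential

/-- Subadditivity gives (1+t)^s ≤ 1 + t^s; then log r ≤ r - 1 is used at r = (1+t)^s. -/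
theorem Real.log_one_add_le_rpow_div {t s : ℝ} (ht : 0 ≤ t) (hs : 0 < s) (hs1 : s ≤ 1) :
    Real.log (1 + t) ≤ t ^ s / s := by
  rw [le_div_iff₀ hs, mul_comm, ← Real.log_rpow (by linarith)]
  have h1 : (1 + t) ^ s ≤ 1 + t ^ s := by
    have := Real.rpow_add_le_add_rpow zero_le_one ht hs.le hs1
    simpa using this
  have h2 := Real.log_le_sub_one_of_pos (show 0 < (1 + t) ^ s by positivity)
  linarith

theorem Real.rpow_neg_mul_rpow_neg_le {A B s t : ℝ} (hA : 0 < A) (hB : 0 < B) (hs : 0 ≤ s)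
    (ht : 0 ≤ t) : A ^ (-s) * B ^ (-t) ≤ A ^ (-(s + t)) + B ^ (-(s + t)) := by
  have hA' := Real.rpow_nonneg hA.le (-(s + t))
  have hB' := Real.rpow_nonneg hB.le (-(s + t))
  rcases le_total A B with h | h
  · have h1 : A ^ (-s) * B ^ (-t) ≤ A ^ (-s) * A ^ (-t) :=
      mul_le_mul_of_nonneg_left (Real.rpow_le_rpow_of_nonpos hA h (by linarith)) (by positivity)
    rw [← Real.rpow_add hA, ← neg_add] at h1
    linarith
  · have h1 : A ^ (-s) * B ^ (-t) ≤ B ^ (-s) * B ^ (-t) :=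
      mul_le_mul_of_nonneg_right (Real.rpow_le_rpow_of_nonpos hB h (by linarith)) (by positivity)
    rw [← Real.rpow_add hB, ← neg_add] at h1
    linarith

variable {N : ℕ}

/-- A single power |z|^δ with δ ≤ β bounds log^β(1+|z|) both at the origin, making the singularity
integrable, and at infinity. -/
theorem exists_logRieszKernel_le {β δ : ℝ} (hδ : 0 < δ) (hδβ : δ ≤ β) :
    ∃ C, 0 < C ∧ ∀ z : EuclideanSpace ℝ (Fin N),
      logRieszKernel N N β z ≤ C * ‖z‖ ^ (δ - N) := by
  have hβ : 0 < β := hδ.trans_le hδβ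
  set s := δ / β
  have hs : 0 < s := by positivity
  have hs1 : s ≤ 1 := (div_le_one hβ).2 hδβ
  refine ⟨(s ^ β)⁻¹, by positivity, fun z => ?_⟩
  rcases eq_or_ne z 0 with rfl | hz
  · simp only [logRieszKernel, norm_zero, add_zero, Real.log_one, Real.zero_rpow hβ.ne', mul_zero]
    exact mul_nonneg (by positivity) (Real.rpow_nonneg le_rfl _)
  have hz' : 0 < ‖z‖ := norm_pos_iff.2 hz
  have h1 : Real.log (1 + ‖z‖) ^ β ≤ (‖z‖ ^ s / s) ^ β :=
    Real.rpow_le_rpow (Real.log_nonneg (by linarith))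
      (Real.log_one_add_le_rpow_div hz'.le hs hs1) hβ.le
  rw [Real.div_rpow (by positivity) hs.le, ← Real.rpow_mul hz'.le,
    show s * β = δ by simp only [s]; field_simp] at h1
  calc logRieszKernel N N β z ≤ ‖z‖ ^ (-(N : ℝ)) * (‖z‖ ^ δ / s ^ β) :=
        mul_le_mul_of_nonneg_left h1 (by positivity)
    _ = (s ^ β)⁻¹ * ‖z‖ ^ (δ - N) := by
        rw [sub_eq_neg_add, Real.rpow_add hz']
        ring

theorem measurable_logRieszKernel (α β : ℝ) : Measurable (logRieszKernel N α β) := by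
  unfold logRieszKernel
  fun_prop

/-- Pointwise splitting used to bound Riesz potentials of decaying functions. -/
theorem norm_rpow_mul_rpow_le {n δ b : ℝ} (hδ : 0 < δ) (hb : 2 * δ ≤ b) (hbn : b ≤ n)
    {E : Type*} [NormedAddCommGroup E] (x z : E) :
    ‖z‖ ^ (δ - n) * (1 + ‖x - z‖) ^ (-b) ≤ 2 ^ (n + b) * (1 + ‖x‖) ^ (-(b - 2 * δ)) *
      ((Metric.ball (0 : E) 1).indicator (fun z => ‖z‖ ^ (δ - n)) z +
        ((1 + ‖z‖) ^ (-(n + δ)) + (1 + ‖x - z‖) ^ (-(n + δ)))) := by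
  set X := 1 + ‖x‖
  set Y := 1 + ‖x - z‖
  set Z := 1 + ‖z‖
  have hx1 : 1 ≤ X := by simp only [X]; linarith [norm_nonneg x]
  have hy1 : 1 ≤ Y := by simp only [Y]; linarith [norm_nonneg (x - z)]
  have hz1 : 1 ≤ Z := by simp only [Z]; linarith [norm_nonneg z]
  have hX : 0 < X := by linarith
  have hY : 0 < Y := by linarith
  have hZ : 0 < Z := by linarith
  have htri : X ≤ ‖z‖ + Y := by
    have : ‖x‖ ≤ ‖x - z‖ + ‖z‖ := by simpa using norm_add_le (x - z) z
    simp only [X, Y]; linarith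
  have hhalf : ∀ {W c : ℝ}, 0 ≤ c → X / 2 ≤ W → W ^ (-c) ≤ 2 ^ c * X ^ (-c) := by
    intro W c hc hW
    calc W ^ (-c) ≤ (X / 2) ^ (-c) :=
          Real.rpow_le_rpow_of_nonpos (by positivity) hW (by linarith)
      _ = 2 ^ c * X ^ (-c) := by
          rw [Real.div_rpow hX.le zero_le_two, Real.rpow_neg zero_le_two, div_inv_eq_mul, mul_comm]
  have hYn : 0 ≤ Y ^ (-(n + δ)) := by positivity
  have hZn : 0 ≤ Z ^ (-(n + δ)) := by positivity
  by_cases hzB : z ∈ Metric.ball (0 : E) 1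
  · rw [Set.indicator_of_mem hzB]
    have hz : ‖z‖ < 1 := by simpa using hzB
    have h1 : Y ^ (-b) ≤ 2 ^ (n + b) * X ^ (-(b - 2 * δ)) :=
      calc Y ^ (-b) ≤ 2 ^ b * X ^ (-b) := hhalf (by linarith) (by linarith)
        _ ≤ 2 ^ (n + b) * X ^ (-(b - 2 * δ)) := by
          gcongr
          · norm_num
          · linarith
          · linarith
    calc ‖z‖ ^ (δ - n) * Y ^ (-b) ≤ ‖z‖ ^ (δ - n) * (2 ^ (n + b) * X ^ (-(b - 2 * δ))) := by gcongr
      _ = 2 ^ (n + b) * X ^ (-(b - 2 * δ)) * (‖z‖ ^ (δ - n) + 0) := by ring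
      _ ≤ _ := by gcongr; positivity
  · rw [Set.indicator_of_notMem hzB, zero_add]
    have hz : 1 ≤ ‖z‖ := by simpa using hzB
    have h1 : ‖z‖ ^ (δ - n) ≤ 2 ^ (n - δ) * Z ^ (-(n - δ)) := by
      calc ‖z‖ ^ (δ - n) ≤ (Z / 2) ^ (δ - n) :=
            Real.rpow_le_rpow_of_nonpos (by positivity) (by simp only [Z]; linarith) (by linarith)
        _ = 2 ^ (n - δ) * Z ^ (-(n - δ)) := by
            rw [Real.div_rpow hZ.le zero_le_two, ← neg_sub n δ, Real.rpow_neg zero_le_two,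
              div_inv_eq_mul, mul_comm]
    have h2 : Z ^ (-(n - δ)) * Y ^ (-b) ≤ 2 ^ (b - 2 * δ) * X ^ (-(b - 2 * δ)) *
        (Z ^ (-(n + δ)) + Y ^ (-(n + δ))) := by
      -- One of Y, Z is at least X/2. That factor yields the decay in X, and the remaining exponents
      -- add up to n + δ, which is integrable.
      rcases le_or_gt (X / 2) Y with hXY | hXY
      · have e1 : Y ^ (-b) = Y ^ (-(b - 2 * δ)) * Y ^ (-(2 * δ)) := by
          rw [← Real.rpow_add hY]; congr 1; ring
        have e2 := Real.rpow_neg_mul_rpow_neg_le hZ hY (by linarith : 0 ≤ n - δ)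
          (by linarith : 0 ≤ 2 * δ)
        rw [show n - δ + 2 * δ = n + δ by ring] at e2
        calc Z ^ (-(n - δ)) * Y ^ (-b)
            = Y ^ (-(b - 2 * δ)) * (Z ^ (-(n - δ)) * Y ^ (-(2 * δ))) := by rw [e1]; ring
          _ ≤ _ := mul_le_mul (hhalf (by linarith) hXY) e2 (by positivity) (by positivity)
      · have hXZ : X / 2 ≤ Z := by simp only [Z]; linarith
        have e1 : Z ^ (-(n - δ)) = Z ^ (-(b - 2 * δ)) * Z ^ (-(n + δ - b)) := by
          rw [← Real.rpow_add hZ]; congr 1; ring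
        have e2 := Real.rpow_neg_mul_rpow_neg_le hZ hY (by linarith : 0 ≤ n + δ - b)
          (by linarith : 0 ≤ b)
        rw [show n + δ - b + b = n + δ by ring] at e2
        calc Z ^ (-(n - δ)) * Y ^ (-b)
            = Z ^ (-(b - 2 * δ)) * (Z ^ (-(n + δ - b)) * Y ^ (-b)) := by rw [e1]; ring
          _ ≤ _ := mul_le_mul (hhalf (by linarith) hXZ) e2 (by positivity) (by positivity)
    calc ‖z‖ ^ (δ - n) * Y ^ (-b) ≤ 2 ^ (n - δ) * Z ^ (-(n - δ)) * Y ^ (-b) := by gcongr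
      _ = 2 ^ (n - δ) * (Z ^ (-(n - δ)) * Y ^ (-b)) := by ring
      _ ≤ 2 ^ (n - δ) * (2 ^ (b - 2 * δ) * X ^ (-(b - 2 * δ)) *
          (Z ^ (-(n + δ)) + Y ^ (-(n + δ)))) := by gcongr
      _ = 2 ^ (n - δ + (b - 2 * δ)) * X ^ (-(b - 2 * δ)) * (Z ^ (-(n + δ)) + Y ^ (-(n + δ))) := by
          rw [Real.rpow_add zero_lt_two]; ring
      _ ≤ _ := by
          gcongr
          · norm_num
          · linarith
          · linarith

/-- The Riesz potential of a power of `1 + ‖x‖` loses arbitrarily little decay. -/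
theorem exists_integral_riesz_le (hN : 1 ≤ N) {δ b : ℝ} (hδ : 0 < δ) (hb : 2 * δ ≤ b)
    (hbN : b ≤ N) :
    ∃ D, 0 < D ∧ ∀ x : EuclideanSpace ℝ (Fin N),
      Integrable (fun z => ‖z‖ ^ (δ - N) * (1 + ‖x - z‖) ^ (-b)) ∧
      ∫ z, ‖z‖ ^ (δ - N) * (1 + ‖x - z‖) ^ (-b) ≤ D * (1 + ‖x‖) ^ (-(b - 2 * δ)) := by
  have hN' : (1 : ℝ) ≤ N := by exact_mod_cast hN
  let f₁ : EuclideanSpace ℝ (Fin N) → ℝ :=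
    (Metric.ball 0 1).indicator fun z => ‖z‖ ^ (δ - N)
  let f₂ : EuclideanSpace ℝ (Fin N) → ℝ := fun z => (1 + ‖z‖) ^ (-(N + δ))
  have h1 : Integrable f₁ := by
    refine (integrable_indicator_iff measurableSet_ball).2 ?_
    refine integrableOn_ball_of_norm_le_rpow (C := 1) (α := N - δ) (by simpa using hN)
      (by simpa using hδ) (Eventually.of_forall fun z => ?_)
      (Measurable.aestronglyMeasurable (by fun_prop))
    rw [Real.norm_of_nonneg (by positivity), one_mul, neg_sub]
  have h2 : Integrable f₂ := integrable_one_add_norm (by simpa using hδ)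
  have h3 : ∀ x, Integrable fun z => f₂ (x - z) := fun x => h2.comp_sub_left x
  have hf₁ : 0 ≤ ∫ z, f₁ z := integral_nonneg fun z =>
    Set.indicator_nonneg (fun _ _ => by positivity) z
  have hf₂ : 0 ≤ ∫ z, f₂ z := integral_nonneg fun z => by simp only [f₂, Pi.zero_apply]; positivity
  set I := (∫ z, f₁ z) + ((∫ z, f₂ z) + ∫ z, f₂ z)
  refine ⟨2 ^ (N + b) * (I + 1), by positivity, fun x => ?_⟩
  have hdom : Integrable fun z => 2 ^ (N + b) * (1 + ‖x‖) ^ (-(b - 2 * δ)) *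
      (f₁ z + (f₂ z + f₂ (x - z))) := (h1.add (h2.add (h3 x))).const_mul _
  have hle := fun z => norm_rpow_mul_rpow_le (n := N) hδ hb hbN x z
  have hint : Integrable fun z => ‖z‖ ^ (δ - N) * (1 + ‖x - z‖) ^ (-b) := by
    refine hdom.mono' (Measurable.aestronglyMeasurable (by fun_prop))
      (Eventually.of_forall fun z => ?_)
    rw [Real.norm_of_nonneg (by positivity)]
    exact hle z
  refine ⟨hint, (integral_mono hint hdom hle).trans ?_⟩
  have hsum : ∫ z, (f₁ z + (f₂ z + f₂ (x - z))) = I := by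
    rw [integral_add h1 (g := fun z => f₂ z + f₂ (x - z)) (h2.add (h3 x)),
      integral_add h2 (h3 x), integral_sub_left_eq_self f₂]
  rw [integral_const_mul, hsum]
  calc 2 ^ (N + b) * (1 + ‖x‖) ^ (-(b - 2 * δ)) * I
      ≤ 2 ^ (N + b) * (1 + ‖x‖) ^ (-(b - 2 * δ)) * (I + 1) := by gcongr; linarith
    _ = _ := by ring

end Potential

/-- The convolution of the logarithmic kernel with a power of `1 + ‖x‖²`. -/
theorem exists_integral_logRieszKernel_le {N : ℕ} (hN : 1 ≤ N) {β δ b s : ℝ} (hδ : 0 < δ)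
    (hδβ : δ ≤ β) (hb : 2 * δ ≤ b) (hbN : b ≤ N) (hbs : b ≤ 2 * s) :
    ∃ D, 0 < D ∧ ∀ x : EuclideanSpace ℝ (Fin N),
      Integrable (fun z => logRieszKernel N N β z * (1 + ‖x - z‖ ^ 2) ^ (-s)) ∧
      ∫ z, logRieszKernel N N β z * (1 + ‖x - z‖ ^ 2) ^ (-s) ≤
        D * (1 + ‖x‖ ^ 2) ^ (-((b - 2 * δ) / 2)) := by
  obtain ⟨C, hC, hK⟩ := exists_logRieszKernel_le (N := N) hδ hδβ
  obtain ⟨D, hD, hint⟩ := exists_integral_riesz_le hN hδ hb hbN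
  have hb0 : 0 < b := by linarith
  refine ⟨C * 2 ^ (b / 2) * D, by positivity, fun x => ?_⟩
  obtain ⟨hi, hle⟩ := hint x
  have hpt : ∀ z, logRieszKernel N N β z * (1 + ‖x - z‖ ^ 2) ^ (-s) ≤
      C * 2 ^ (b / 2) * (‖z‖ ^ (δ - N) * (1 + ‖x - z‖) ^ (-b)) := by
    intro z
    have h1 : (1 + ‖x - z‖ ^ 2) ^ (-s) ≤ 2 ^ (b / 2) * (1 + ‖x - z‖) ^ (-b) :=
      (Real.rpow_le_rpow_of_exponent_le (by nlinarith [sq_nonneg ‖x - z‖]) (by linarith)).trans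
        (rpow_neg_one_add_norm_sq_le (x - z) hb0)
    calc _ ≤ C * ‖z‖ ^ (δ - N) * (2 ^ (b / 2) * (1 + ‖x - z‖) ^ (-b)) :=
          mul_le_mul (hK z) h1 (by positivity) (by positivity)
      _ = _ := by ring
  have hint : Integrable fun z => logRieszKernel N N β z * (1 + ‖x - z‖ ^ 2) ^ (-s) := by
    refine (hi.const_mul (C * 2 ^ (b / 2))).mono' ?_ (Eventually.of_forall fun z => ?_)
    · exact ((measurable_logRieszKernel _ _).mul (by fun_prop)).aestronglyMeasurable
    · rw [Real.norm_of_nonneg (mul_nonneg (logRieszKernel_nonneg _ _ _) (by positivity))]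
      exact hpt z
  refine ⟨hint, (integral_mono hint (hi.const_mul _) hpt).trans ?_⟩
  rw [integral_const_mul, mul_assoc _ D]
  refine mul_le_mul_of_nonneg_left (hle.trans (mul_le_mul_of_nonneg_left ?_ hD.le)) (by positivity)
  have h1 : 1 + ‖x‖ ^ 2 ≤ (1 + ‖x‖) ^ 2 := by nlinarith [norm_nonneg x]
  calc (1 + ‖x‖) ^ (-(b - 2 * δ)) = ((1 + ‖x‖) ^ 2) ^ (-((b - 2 * δ) / 2)) := by
        rw [← Real.rpow_natCast_mul (by positivity)]
        congr 1
        push_cast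
        ring
    _ ≤ _ := Real.rpow_le_rpow_of_nonpos (by positivity) h1 (by linarith)

/-- The exponent condition is sufficient. -/
theorem exists_isNonnegSolution {N : ℕ} (hN : 3 ≤ N) {p q β : ℝ} (hp : 1 ≤ p) (hq : 0 < q)
    (hβ : 0 < β) (hcrit : (N : ℝ) / ((N : ℝ) - 2) < p + q) :
    ∃ lam : ℝ, 0 < lam ∧
      ∃ u : EuclideanSpace ℝ (Fin N) → ℝ, IsNonnegSolution N (N : ℝ) β lam p q u := by
  have hN3 : (3 : ℝ) ≤ N := by exact_mod_cast hN
  have hN2 : (0 : ℝ) < N - 2 := by linarith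
  have hr : 0 < p + q - 1 := by linarith
  rw [div_lt_iff₀ hN2] at hcrit
  -- a < N-2 keeps the profile superharmonic with a positive leading coefficient; a(p+q-1) > 2 makes
  -- the right side decay faster than the left.
  obtain ⟨a, ha1, ha2⟩ := exists_between (show 2 / (p + q - 1) < (N : ℝ) - 2 by
    rw [div_lt_iff₀ hr]; linarith)
  rw [div_lt_iff₀ hr] at ha1
  have ha : 0 < a := by
    by_contra! h
    nlinarith
  obtain ⟨b, hb1, hb2⟩ := exists_between (show max 0 (a + 2 - a * q) < min (a * p) N by
    refine max_lt (lt_min (by positivity) (by linarith)) (lt_min (by linarith) ?_)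
    have : 0 < a * q := by positivity
    linarith)
  obtain ⟨hb0, hbq⟩ := max_lt_iff.1 hb1
  obtain ⟨hbp, hbN⟩ := lt_min_iff.1 hb2
  set δ := min β (min (b / 2) ((b + a * q - a - 2) / 2))
  have hδ : 0 < δ := lt_min hβ (lt_min (by linarith) (by linarith))
  have hδβ : δ ≤ β := min_le_left _ _
  have hδb : δ ≤ b / 2 := (min_le_right _ _).trans (min_le_left _ _)
  have hδq : δ ≤ (b + a * q - a - 2) / 2 := (min_le_right _ _).trans (min_le_right _ _)
  set s := a / 2
  have hs : 0 < s := by positivity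
  obtain ⟨D, hD, hconv⟩ := exists_integral_logRieszKernel_le (N := N) (by omega) (s := s * p)
    hδ hδβ (by linarith : 2 * δ ≤ b) hbN.le (by simp only [s]; linarith)
  obtain ⟨lam, hlam, hΔ⟩ := exists_le_bilaplacian_sub_laplacian
    (E := EuclideanSpace ℝ (Fin N)) hs (by rw [finrank_euclideanSpace_fin]; simp only [s]; linarith)
  -- Solves ε^(p+q) D = ε; p + q > 1 is needed.
  set ε := D ^ (-(p + q - 1)⁻¹)
  have hε : 0 < ε := Real.rpow_pos_of_pos hD _
  have hεD : ε ^ p * D * ε ^ q = ε := by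
    have h1 : ε ^ (p + q - 1) = D⁻¹ := by
      simp only [ε]
      rw [← Real.rpow_mul hD.le, neg_mul, inv_mul_cancel₀ hr.ne', Real.rpow_neg_one]
    have h2 : ε ^ p * ε ^ q = ε ^ (p + q - 1) * ε := by
      rw [← Real.rpow_add hε, ← Real.rpow_add_one hε.ne']; congr 1; ring
    rw [mul_right_comm, h2, h1]
    field_simp
  let F : EuclideanSpace ℝ (Fin N) → ℝ := fun y => (1 + ‖y‖ ^ 2) ^ (-s)
  have hF : ∀ n : WithTop ℕ∞, ContDiff ℝ n F := fun n => contDiff_rpow_one_add_norm_sq _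
  have hpow : ∀ (t : ℝ) (y : EuclideanSpace ℝ (Fin N)),
      (ε * F y) ^ t = ε ^ t * (1 + ‖y‖ ^ 2) ^ (-(s * t)) := by
    intro t y
    change (ε * (1 + ‖y‖ ^ 2) ^ (-s)) ^ t = _
    rw [Real.mul_rpow hε.le (by positivity), ← Real.rpow_mul (x := 1 + ‖y‖ ^ 2) (by positivity),
      neg_mul]
  have hK : ∀ x z, logRieszKernel N N β z * (ε * F (x - z)) ^ p =
      ε ^ p * (logRieszKernel N N β z * (1 + ‖x - z‖ ^ 2) ^ (-(s * p))) := by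
    intro x z
    rw [hpow]
    ring
  have hΔε : Δ (fun y => ε * F y) = ε • Δ F := by
    ext x
    exact InnerProductSpace.laplacian_smul ε (hF 2).contDiffAt
  refine ⟨lam, hlam, fun y => ε * F y, contDiff_const.mul (hF 4),
    fun x => by simp only [F]; positivity, ⟨0, ?_⟩, fun x => ?_, fun x => ?_⟩
  · simp only [F]
    positivity
  · change Integrable fun z => logRieszKernel N N β z * (ε * F (x - z)) ^ p
    simp_rw [hK]
    exact (hconv x).1.const_mul _
  · change (∫ z, logRieszKernel N N β z * (ε * F (x - z)) ^ p) * (ε * F x) ^ q ≤ _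
    simp_rw [hK]
    have hJ : 1 ≤ 1 + ‖x‖ ^ 2 := by nlinarith [sq_nonneg ‖x‖]
    rw [integral_const_mul, hpow, hΔε,
      InnerProductSpace.laplacian_smul ε ((hF 4).laplacian (m := 2) (by norm_num)).contDiffAt]
    simp only [Pi.smul_apply, smul_eq_mul]
    calc ε ^ p * (∫ z, logRieszKernel N N β z * (1 + ‖x - z‖ ^ 2) ^ (-(s * p))) *
          (ε ^ q * (1 + ‖x‖ ^ 2) ^ (-(s * q)))
        ≤ ε ^ p * (D * (1 + ‖x‖ ^ 2) ^ (-((b - 2 * δ) / 2))) *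
          (ε ^ q * (1 + ‖x‖ ^ 2) ^ (-(s * q))) := by gcongr; exact (hconv x).2
      _ = (ε ^ p * D * ε ^ q) * (1 + ‖x‖ ^ 2) ^ (-((b - 2 * δ) / 2) + -(s * q)) := by
          rw [Real.rpow_add (by positivity)]
          ring
      _ ≤ ε * (1 + ‖x‖ ^ 2) ^ (-(s + 1)) := by
          rw [hεD]
          gcongr
          · simp only [s]; linarith
      _ ≤ ε * (Δ (Δ F) x - lam * Δ F x) := mul_le_mul_of_nonneg_left (hΔ x) hε.le
      _ = _ := by ring

end Sufficiency

end

theorem theorem4 (N : ℕ) (hN : 3 ≤ N) (p q β : ℝ) (hp : 1 ≤ p) (hq : 0 < q) (hβ : 0 < β) :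
    (∃ lam : ℝ, 0 < lam ∧
      ∃ u : EuclideanSpace ℝ (Fin N) → ℝ, IsNonnegSolution N (N : ℝ) β lam p q u) ↔
      (N : ℝ) / ((N : ℝ) - 2) < p + q := by
  refine ⟨?_, exists_isNonnegSolution hN hp hq hβ⟩
  rintro ⟨lam, hlam, u, hu⟩
  exact hu.div_lt_add hN hp hq hβ hlam
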